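/- **Setting.** For every $m$ let $p_{1,m},\dots,p_{m,m}\in[0,1]$ be $p$-values on a probability space $(\Omega_m,\mathcal A_m,P_m)$, and let $\{1,\dots,m\}=I_{0,m}\cup I_{1,m}$ be a nonrandom disjoint decomposition into true and false nulls, $m_j=\#I_{j,m}$. Assume basic independence: the vectors $(p_{i,m})_{i\in I_{0,m}}$ and $(p_{i,m})_{i\in I_{1,m}}$ are independent, and $(p_{i,m})_{i\in I_{0,m}}$ are independent and uniformly distributed on $[0,1]$ (the joint law of $(p_{i,m})_{i\in I_{1,m}}$ is arbitrary). Let $\widehat F_m$ and $\widehat F_{1,m}$ be the empirical distribution functions of $(p_{i,m})_{i\le m}$ and $(p_{i,m})_{i\in I_{1,m}}$, and $R_m(t)=m\widehat F_m(t)$. For critical values $0=c_0<c_1\le\dots\le c_m<1$ the step-up test has $R_m=\max\{i\in\{0,\dots,m\}: p_{i:m}\le c_i\}$ rejections, where $p_{1:m}\le\dots\le p_{m:m}$ are the ordered $p$-values and $p_{0:m}=0$; it rejects the $i$-th null iff $p_{i,m}\le c_{R_m}$, has $V_m=\#\{i\in I_{0,m}:p_{i,m}\le c_{R_m}\}$ false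 rejections, and $\mathrm{FDR}_m=E(V_m/R_m)$ with $0/0=0$. The test is consistent if $V_m/R_m-E(V_m/R_m)\to0$ in $P_m$-probability. All limits are as $m\to\infty$; almost sure statements about such limits refer to an arbitrary joint law of the experiments $(\Omega_m,\mathcal A_m,P_m)$, $m\in\mathbb N$. Let $0<\alpha\le\lambda<1$ and $\lambda=\lambda_0<\lambda_1<\dots<\lambda_k=1$. Let $\widehat\beta_{i,m}\ge0$, $1\le i\le k$, be measurable functions of $(\widehat F_m(t))_{t\ge\lambda_i}$ with $\sum_{i=1}^k\widehat\beta_{i,m}=1$, and put $$\widetilde m_0=\sum_{i=1}^k\widehat\beta_{i,m}\,m\,\frac{\widehat F_m(\lambda_i)-\widehat F_m(\lambda_{i-1})+\frac1m}{\lambda_i-\lambda_{i-1}},\qquad \widehat m_0=\max\Bigl\{\widetilde m_0,\frac{\alpha}{\lambda}R_m(\lambda)\Bigr\}.$$ The adaptive test is the step-up test with critical values $\min\{i\alpha/\widehat m_0,\lambda\}$; the BH test is the one with critical values $i\alpha/m$, and its FDR is denoted $\mathrm{FDR}^{BH}_m$. Put $\widehat g_{i,m}=\widehat\beta_{i,m}/(\lambda_i-\lambda_{i-1})$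 for $1\le i\le k$ and $\widehat g_{0,m}=0$. Assume that $m_0/m\to\kappa_0\in(0,1]$ and $\kappa_0>\alpha(1-\kappa_0)/[\lambda(1-\alpha)]$. **Corollary.** (a) If $\kappa_0=1$, then $\widehat m_0/m\to1$ in $P_m$-probability and $\lim\mathrm{FDR}_m=\alpha=\lim\mathrm{FDR}_m^{BH}$. (b) Let $\kappa_0<1$ and suppose that for every $m$, almost surely, $\widehat g_{1,m}\le\widehat g_{2,m}\le\dots\le\widehat g_{k,m}$. Let $\varepsilon_i\in[0,1-\lambda_i]$, $0\le i\le k-1$, be such that $\liminf_m\widehat F_m(\lambda_i)\ge\lambda_i+\varepsilon_i$ almost surely for $0\le i\le k-1$. If there are $j\in\{1,\dots,k\}$ and $\delta>0$ with $\liminf_m(\widehat g_{j,m}-\widehat g_{j-1,m})\ge\delta$ almost surely and $\varepsilon_{j-1}>0$, then $$\liminf_{m\to\infty}\mathrm{FDR}_m>\kappa_0\alpha=\lim_{m\to\infty}\mathrm{FDR}_m^{BH}.$$ (c) Suppose that there are constants $\beta_i$ with $\widehat\beta_{i,m}\to\beta_i$ almost surely for $1\le i\le k$, that the monotonicity condition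 on the weights in (b) holds, and that $\lim_m\widehat F_{1,m}(\lambda_i)=\lambda_i+\varepsilon_i$ almost surely with some $\varepsilon_i\in[0,1-\lambda_i]$ for $0\le i\le k-1$. Put $g_i=\beta_i/(\lambda_i-\lambda_{i-1})$ for $1\le i\le k$ and $g_0=0$, and assume $g_j-g_{j-1}>0$ and $\varepsilon_{j-1}>0$ for some $j\in\{1,\dots,k\}$. If $\kappa_0=1$, assume in addition $m_1/\sqrt m\to\infty$. Then there is $C_0\in[\kappa_0\alpha,1]$ such that $\widehat m_0/m\to C_0$ in $P_m$-probability, and - consistency of the BH test implies consistency of the adaptive test; - if there are $\delta>0$ and $t_m\in(0,\lambda)$ with $mt_m\to\infty$ and $$P_m\Bigl(\frac{m_1}{m}\frac{\widehat F_{1,m}(t_m)}{t_m}\ge\delta-\kappa_0+\frac{C_0}{\alpha}\Bigr)\to1,$$ then the adaptive test is consistent. -/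

import Mathlib

open MeasureTheory ProbabilityTheory Filter Topology

noncomputable section

namespace MultipleTesting

/-- Basic independence (BI) for the `p`-values `p · 1, …, p · m` with set `I₀` of true nulls:
the vector of `p`-values of the true nulls is independent of the vector of `p`-values of the
false nulls, and the former consists of independent, uniformly distributed variables. The joint
law of the `p`-values of the false nulls is arbitrary. -/
structure BasicIndependence {Ω : Type*} [MeasurableSpace Ω] (P : Measure Ω) {m : ℕ}
    (p : Ω → Fin m → ℝ) (I₀ : Finset (Fin m)) : Prop where
  measurable : ∀ i, Measurable fun ω => p ω i
  mem_Icc : ∀ ω i, p ω i ∈ Set.Icc (0 : ℝ) 1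
  indep_true_false :
    IndepFun (fun ω (i : {i // i ∈ I₀}) => p ω i) (fun ω (i : {i // i ∉ I₀}) => p ω i) P
  indep_true : iIndepFun (fun (i : {i // i ∈ I₀}) ω => p ω i) P
  uniform_true : ∀ i ∈ I₀, ∀ x ∈ Set.Icc (0 : ℝ) 1, P {ω | p ω i ≤ x} = ENNReal.ofReal x

/-- Empirical distribution function at `t` of the values `q i`, `i ∈ s` (`0` if `s` is empty). -/
def empCDF {m : ℕ} (s : Finset (Fin m)) (q : Fin m → ℝ) (t : ℝ) : ℝ :=
  ((s.filter fun i => q i ≤ t).card : ℝ) / (s.card : ℝ)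

/-- The `i`-th smallest of the values `q 1, …, q m` for `1 ≤ i ≤ m`; the `0`-th one is `0`. -/
def orderStat {m : ℕ} (q : Fin m → ℝ) (i : ℕ) : ℝ :=
  if h : 1 ≤ i ∧ i ≤ m then q (Tuple.sort q ⟨i - 1, by omega⟩) else 0

open Classical in
/-- Number of rejections `max {i = 0, …, m : p_{i:m} ≤ c i}` of the step-up test with critical
values `c`. -/
def numRej {m : ℕ} (c : ℕ → ℝ) (q : Fin m → ℝ) : ℕ :=
  Nat.findGreatest (fun i => orderStat q i ≤ c i) m

/-- Number of falsely rejected hypotheses: the `i`-th null is rejected iff its `p`-value is at most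
the critical value with index `numRej c q`. -/
def numFalseRej {m : ℕ} (c : ℕ → ℝ) (q : Fin m → ℝ) (I₀ : Finset (Fin m)) : ℕ :=
  (I₀.filter fun i => q i ≤ c (numRej c q)).card

/-- False discovery proportion `V / R`, with `0 / 0 = 0`. -/
def FDP {m : ℕ} (c : ℕ → ℝ) (q : Fin m → ℝ) (I₀ : Finset (Fin m)) : ℝ :=
  (numFalseRej c q I₀ : ℝ) / (numRej c q : ℝ)

/-- Critical values `i α / m` of the Benjamini-Hochberg test. -/
def critBH (α : ℝ) (m : ℕ) (i : ℕ) : ℝ := (i : ℝ) / (m : ℝ) * α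

/-- Critical values `min (i α / m₀) l` of the adaptive test with estimate `m₀` and cap `l`. -/
def critAdaptive (α l m₀ : ℝ) (i : ℕ) : ℝ := min ((i : ℝ) / m₀ * α) l

/-- The estimator of the number of true nulls on the interval `(lam (i - 1), lam i]`, `1 ≤ i`. -/
def storeyInterval {m : ℕ} (lam : ℕ → ℝ) (q : Fin m → ℝ) (i : ℕ) : ℝ :=
  (m : ℝ) *
    ((empCDF Finset.univ q (lam i) - empCDF Finset.univ q (lam (i - 1)) + 1 / (m : ℝ)) /
      (lam i - lam (i - 1)))

/-- Weights `b i ((F_m(t))_{t ≥ lam i})` evaluated at the `p`-values `q`. -/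
def weights {m : ℕ} {lam : ℕ → ℝ} (b : ∀ i, (Set.Ici (lam i) → ℝ) → ℝ) (q : Fin m → ℝ) (i : ℕ) :
    ℝ :=
  b i fun t => empCDF Finset.univ q t

/-- The combined estimator `∑_{i=1}^k β i * storeyInterval lam q i`. -/
def storeyComb {m : ℕ} (k : ℕ) (lam : ℕ → ℝ) (β : ℕ → ℝ) (q : Fin m → ℝ) : ℝ :=
  ∑ i ∈ Finset.Icc 1 k, β i * storeyInterval lam q i

/-- The estimator of the adaptive test: the maximum of the combined estimator and
`(α / lam 0) R_m(lam 0)`, where `R_m(t) = m F_m(t)`. -/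
def storeyHat {m : ℕ} (α : ℝ) (k : ℕ) (lam : ℕ → ℝ) (β : ℕ → ℝ) (q : Fin m → ℝ) : ℝ :=
  max (storeyComb k lam β q) (α / lam 0 * ((m : ℝ) * empCDF Finset.univ q (lam 0)))

/-- Normalized weight `β i / (lam i - lam (i - 1))` for `1 ≤ i`, and `0` for `i = 0`. -/
def normWeight (lam : ℕ → ℝ) (β : ℕ → ℝ) (i : ℕ) : ℝ :=
  if i = 0 then 0 else β i / (lam i - lam (i - 1))

/-- `β 1 / (lam 1 - lam 0) ≤ β 2 / (lam 2 - lam 1) ≤ … ≤ β k / (lam k - lam (k - 1))`. -/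
def MonotoneWeights (k : ℕ) (lam : ℕ → ℝ) (β : ℕ → ℝ) : Prop :=
  ∀ i, 1 ≤ i → i < k → normWeight lam β i ≤ normWeight lam β (i + 1)

/-- False discovery proportion of the Benjamini-Hochberg test at level `α`. -/
def fdpBH {m : ℕ} (α : ℝ) (I₀ : Finset (Fin m)) (q : Fin m → ℝ) : ℝ :=
  FDP (critBH α m) q I₀

/-- False discovery proportion of the adaptive test based on `storeyHat`. -/
def fdpStorey {m : ℕ} (α : ℝ) (k : ℕ) (lam : ℕ → ℝ) (b : ∀ i, (Set.Ici (lam i) → ℝ) → ℝ)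
    (I₀ : Finset (Fin m)) (q : Fin m → ℝ) : ℝ :=
  FDP (critAdaptive α (lam 0) (storeyHat α k lam (weights b q) q)) q I₀

/-- Convergence `X m → c` in `P m`-probability along a sequence of probability spaces. -/
def ConvInProb {Ω : ℕ → Type*} [∀ m, MeasurableSpace (Ω m)] (P : ∀ m, Measure (Ω m))
    (X : ∀ m, Ω m → ℝ) (c : ℝ) : Prop :=
  ∀ η : ℝ, 0 < η → Tendsto (fun m => P m {ω | η ≤ |X m ω - c|}) atTop (𝓝 0)

/-- Consistency of a multiple test with false discovery proportions `X m`: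
`X m - E (X m) → 0` in `P m`-probability. -/
def Consistent {Ω : ℕ → Type*} [∀ m, MeasurableSpace (Ω m)] (P : ∀ m, Measure (Ω m))
    (X : ∀ m, Ω m → ℝ) : Prop :=
  ConvInProb P (fun m ω => X m ω - ∫ ω', X m ω' ∂(P m)) 0

/-- `Q` is a joint law of the sequence of experiments `(Ω m, P m)`. Almost sure statements about
`m → ∞` refer to such a joint law; it is not restricted otherwise. If all experiments live on one
probability space, `Q` is the image of its measure under the diagonal map. -/
def IsJointLaw {Ω : ℕ → Type*} [∀ m, MeasurableSpace (Ω m)] (P : ∀ m, Measure (Ω m))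
    (Q : Measure (∀ m, Ω m)) : Prop :=
  ∀ m, MeasurePreserving (Function.eval m) Q (P m)

end MultipleTesting

end

open MultipleTesting

/-!
A leave-one-out argument identifies the false discovery rate of the adaptive test as
`E[V / R] = E[(α / λ) V(λ) / m̂₀]`, where `V(λ)` counts the true nulls with `p`-value at most `λ`.
By the weak law `V(λ) / m → κ₀ λ`, so the rate is governed by the relative estimate `m̂₀ / m`: it
tends to `κ₀ α / C` if `m̂₀ / m → C`, and it exceeds `κ₀ α` in the limit if `m̂₀ / m` stays below
some `c < 1`. Summation by parts turns monotone weights and an excess of small `p`-values into such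
an upper bound; when `κ₀ = 1` the excess, of order `m₁ / m`, still dominates the binomial noise, of
order `1 / √m`, because `m₁ / √m → ∞`.

The adaptive test is consistent as soon as its number of rejections tends to infinity in
probability, since then `V / R` is close to the convergent `(α / λ) V(λ) / m̂₀`. A consistent BH
test has this property: given at most `K` rejections, with conditional probability bounded below no
true null is rejected, so that `V / R` vanishes instead of being close to `κ₀ α`. The adaptive test
rejects at least as much as BH once `m̂₀ ≤ m`.
-/

namespace MultipleTesting

section Whp

variable {Ω : ℕ → Type*} [∀ m, MeasurableSpace (Ω m)] {P : ∀ m, Measure (Ω m)}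

variable (P) in
/-- The filter of events of the sequence of experiments `(Ω m, P m)` whose probability tends to
one. Convergence in probability is convergence along this filter, so that the limit theorems for
filters apply to it. -/
def whp : Filter (Σ m, Ω m) where
  sets := {S | Tendsto (fun m => P m {ω | (⟨m, ω⟩ : Σ m, Ω m) ∉ S}) atTop (𝓝 0)}
  univ_sets := by simp
  sets_of_superset hS hST :=
    tendsto_of_tendsto_of_tendsto_of_le_of_le tendsto_const_nhds hS (fun _ => zero_le)
      fun _ => measure_mono fun _ hω h => hω (hST h)
  inter_sets {S T} hS hT := by
    have hadd := Tendsto.add hS hT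
    rw [add_zero] at hadd
    refine tendsto_of_tendsto_of_tendsto_of_le_of_le tendsto_const_nhds hadd (fun _ => zero_le)
      fun m => (measure_mono fun ω hω => ?_).trans (measure_union_le _ _)
    simpa only [Set.mem_ofPred_eq, Set.mem_union, Set.mem_inter_iff, not_and_or] using hω

theorem eventually_whp_iff {p : (Σ m, Ω m) → Prop} :
    (∀ᶠ x in whp P, p x) ↔ Tendsto (fun m => P m {ω | ¬ p ⟨m, ω⟩}) atTop (𝓝 0) :=
  Iff.rfl

theorem eventually_whp_iff_tendsto_measureReal [∀ m, IsFiniteMeasure (P m)]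
    {p : (Σ m, Ω m) → Prop} :
    (∀ᶠ x in whp P, p x) ↔ Tendsto (fun m => (P m).real {ω | ¬ p ⟨m, ω⟩}) atTop (𝓝 0) :=
  eventually_whp_iff.trans
    (ENNReal.tendsto_toReal_zero_iff fun _ => measure_ne_top _ _).symm

theorem convInProb_iff_tendsto_whp {X : ∀ m, Ω m → ℝ} {c : ℝ} :
    ConvInProb P X c ↔ Tendsto (fun x : Σ m, Ω m => X x.1 x.2) (whp P) (𝓝 c) := by
  simp only [Metric.tendsto_nhds, eventually_whp_iff, Real.dist_eq, not_lt, ConvInProb]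

theorem tendsto_fst_whp : Tendsto (fun x : Σ m, Ω m => x.1) (whp P) atTop := by
  refine tendsto_atTop.2 fun M => eventually_whp_iff.2 (tendsto_const_nhds.congr' ?_)
  filter_upwards [eventually_ge_atTop M] with m hm
  simp [hm]

theorem eventually_one_le_fst_whp : ∀ᶠ x in whp P, 1 ≤ x.1 :=
  tendsto_fst_whp.eventually (eventually_ge_atTop 1)

theorem tendsto_whp_of_consistent {X : ∀ m, Ω m → ℝ} (hX : Consistent P X) {c : ℝ}
    (h : Tendsto (fun m => ∫ ω, X m ω ∂(P m)) atTop (𝓝 c)) :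
    Tendsto (fun x : Σ m, Ω m => X x.1 x.2) (whp P) (𝓝 c) := by
  simpa only [Function.comp_apply, sub_add_cancel, zero_add] using
    (convInProb_iff_tendsto_whp.1 hX).add (h.comp tendsto_fst_whp)

theorem tendsto_const_div_fst_whp (c : ℝ) :
    Tendsto (fun x : Σ m, Ω m => c / (x.1 : ℝ)) (whp P) (𝓝 0) :=
  (tendsto_const_div_atTop_nhds_zero_nat c).comp tendsto_fst_whp

instance whp_neBot [∀ m, IsProbabilityMeasure (P m)] : (whp P).NeBot := by
  refine ⟨fun hbot => zero_ne_one (α := ENNReal) ?_⟩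
  have hfalse : ∀ᶠ _ in whp P, False := hbot ▸ eventually_bot
  have hone : Tendsto (fun m => P m {_ω | ¬ False}) atTop (𝓝 1) := by simp
  exact tendsto_nhds_unique (eventually_whp_iff.1 hfalse) hone

theorem eventually_whp_of_forall_ae {p : ∀ m, Ω m → Prop} (h : ∀ m, ∀ᵐ ω ∂(P m), p m ω) :
    ∀ᶠ x in whp P, p x.1 x.2 :=
  eventually_whp_iff.2 (tendsto_const_nhds.congr fun m => (ae_iff.1 (h m)).symm)

theorem eventually_whp_iff_tendsto_measure_one [∀ m, IsProbabilityMeasure (P m)]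
    {p : ∀ m, Ω m → Prop} (hp : ∀ m, MeasurableSet {ω | p m ω}) :
    (∀ᶠ x in whp P, p x.1 x.2) ↔ Tendsto (fun m => P m {ω | p m ω}) atTop (𝓝 1) := by
  have hcompl : ∀ m, P m {ω | p m ω} = 1 - P m {ω | ¬ p m ω} := fun m => by
    simpa only [Set.compl_ofPred, not_not] using prob_compl_eq_one_sub (μ := P m) (hp m).compl
  have hsub {u : ℕ → ENNReal} {a : ENNReal} (hu : Tendsto u atTop (𝓝 a)) :
      Tendsto (fun m => 1 - u m) atTop (𝓝 (1 - a)) :=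
    ENNReal.Tendsto.sub tendsto_const_nhds hu (Or.inl ENNReal.one_ne_top)
  rw [eventually_whp_iff]
  constructor
  · intro h
    simpa only [hcompl, tsub_zero] using hsub h
  · intro h
    rw [← tsub_self (1 : ENNReal)]
    exact (hsub h).congr fun m => (prob_compl_eq_one_sub (hp m)).symm

theorem eventually_whp_of_ae_eventually [∀ m, IsProbabilityMeasure (P m)]
    {Q : Measure (∀ m, Ω m)} (hQ : IsJointLaw P Q) {p : ∀ m, Ω m → Prop}
    (hp : ∀ m, MeasurableSet {ω | p m ω}) (h : ∀ᵐ ω ∂Q, ∀ᶠ m in atTop, p m (ω m)) :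
    ∀ᶠ x in whp P, p x.1 x.2 := by
  have : IsProbabilityMeasure (Q.map (Function.eval 0)) := (hQ 0).map_eq ▸ inferInstance
  have : IsProbabilityMeasure Q := Measure.isProbabilityMeasure_of_map (Function.eval 0)
  have hmeas : ∀ m, MeasurableSet {ω : ∀ m, Ω m | ¬ p m (ω m)} := fun m =>
    (hQ m).measurable (hp m).compl
  have hprob : ∀ m, P m {ω | ¬ p m ω} = Q {ω | ¬ p m (ω m)} := fun m =>
    ((hQ m).measure_preimage (hp m).compl.nullMeasurableSet).symm
  simp only [eventually_whp_iff, hprob]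
  rw [← measure_empty (μ := Q)]
  refine tendsto_measure_of_ae_tendsto_indicator_of_isFiniteMeasure atTop MeasurableSet.empty
    hmeas ?_
  filter_upwards [h] with ω hω
  filter_upwards [hω] with m hm
  simp [hm]

theorem tendsto_whp_of_ae_tendsto [∀ m, IsProbabilityMeasure (P m)]
    {Q : Measure (∀ m, Ω m)} (hQ : IsJointLaw P Q) {X : ∀ m, Ω m → ℝ}
    (hX : ∀ m, Measurable (X m)) {c : ℝ}
    (h : ∀ᵐ ω ∂Q, Tendsto (fun m => X m (ω m)) atTop (𝓝 c)) :
    Tendsto (fun x : Σ m, Ω m => X x.1 x.2) (whp P) (𝓝 c) := by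
  refine Metric.tendsto_nhds.2 fun η hη => eventually_whp_of_ae_eventually hQ
    (p := fun m ω => dist (X m ω) c < η)
    (fun m => measurableSet_lt ((hX m).dist measurable_const) measurable_const) ?_
  exact h.mono fun ω hω => Metric.tendsto_nhds.1 hω η hη

theorem eventually_whp_lt_of_ae_le_liminf [∀ m, IsProbabilityMeasure (P m)]
    {Q : Measure (∀ m, Ω m)} (hQ : IsJointLaw P Q) {X : ∀ m, Ω m → ℝ}
    (hX : ∀ m, Measurable (X m)) {B : ℝ} (hB : ∀ m ω, B ≤ X m ω) {c c' : ℝ} (hc : c' < c)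
    (h : ∀ᵐ ω ∂Q, c ≤ liminf (fun m => X m (ω m)) atTop) :
    ∀ᶠ x in whp P, c' < X x.1 x.2 := by
  refine eventually_whp_of_ae_eventually hQ (p := fun m ω => c' < X m ω)
    (fun m => measurableSet_lt measurable_const (hX m)) ?_
  filter_upwards [h] with ω hω
  exact eventually_lt_of_lt_liminf (hc.trans_le hω) (isBoundedUnder_of ⟨B, fun m => hB m (ω m)⟩)

theorem integral_le_add_mul_measureReal {Ω : Type*} [MeasurableSpace Ω] {P : Measure Ω}
    [IsProbabilityMeasure P] {X : Ω → ℝ} (hX : Measurable X) {B : ℝ} (hB : ∀ ω, |X ω| ≤ B)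
    (w : ℝ) : ∫ ω, X ω ∂P ≤ w + (B + |w|) * P.real {ω | ¬ X ω ≤ w} := by
  have hmeas : MeasurableSet {ω | ¬ X ω ≤ w} := (measurableSet_le hX measurable_const).compl
  have hind : Integrable ({ω | ¬ X ω ≤ w}.indicator fun _ => B + |w|) P :=
    (integrable_const _).indicator hmeas
  calc ∫ ω, X ω ∂P ≤ ∫ ω, (w + {ω | ¬ X ω ≤ w}.indicator (fun _ => B + |w|) ω) ∂P := by
        refine integral_mono (.of_bound hX.aestronglyMeasurable B (ae_of_all _ hB))
          ((integrable_const _).add hind) fun ω => ?_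
        by_cases hω : X ω ≤ w
        · simp [hω]
        · simp only [Set.indicator_of_mem (show ω ∈ {ω | ¬ X ω ≤ w} from hω)]
          linarith [le_abs_self (X ω), hB ω, neg_abs_le w]
    _ = w + (B + |w|) * P.real {ω | ¬ X ω ≤ w} := by
        rw [integral_add (integrable_const _) hind, integral_const,
          integral_indicator_const _ hmeas]
        simp [mul_comm]

variable [∀ m, IsProbabilityMeasure (P m)] {X : ∀ m, Ω m → ℝ} {B : ℝ}

theorem eventually_integral_lt_of_eventually_whp_le (hX : ∀ m, Measurable (X m))
    (hB : ∀ m ω, |X m ω| ≤ B) {w w' : ℝ} (hw : w < w') (h : ∀ᶠ x in whp P, X x.1 x.2 ≤ w) :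
    ∀ᶠ m in atTop, ∫ ω, X m ω ∂(P m) < w' := by
  have hlim := ((eventually_whp_iff_tendsto_measureReal.1 h).const_mul (B + |w|)).const_add w
  rw [mul_zero, add_zero] at hlim
  filter_upwards [hlim.eventually_lt_const hw] with m hm
  exact (integral_le_add_mul_measureReal (hX m) (hB m) w).trans_lt hm

theorem eventually_lt_integral_of_eventually_whp_le (hX : ∀ m, Measurable (X m))
    (hB : ∀ m ω, |X m ω| ≤ B) {w w' : ℝ} (hw : w' < w) (h : ∀ᶠ x in whp P, w ≤ X x.1 x.2) :
    ∀ᶠ m in atTop, w' < ∫ ω, X m ω ∂(P m) := by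
  have hneg := eventually_integral_lt_of_eventually_whp_le (P := P) (X := fun m ω => -X m ω)
    (fun m => (hX m).neg) (fun m ω => (abs_neg _).trans_le (hB m ω)) (neg_lt_neg hw)
    (h.mono fun x hx => neg_le_neg hx)
  simpa only [integral_neg, neg_lt_neg_iff] using hneg

theorem tendsto_integral_of_tendsto_whp (hX : ∀ m, Measurable (X m)) (hB : ∀ m ω, |X m ω| ≤ B)
    {c : ℝ} (h : Tendsto (fun x : Σ m, Ω m => X x.1 x.2) (whp P) (𝓝 c)) :
    Tendsto (fun m => ∫ ω, X m ω ∂(P m)) atTop (𝓝 c) := by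
  refine tendsto_order.2 ⟨fun w hw => ?_, fun w hw => ?_⟩
  · obtain ⟨v, hwv, hvc⟩ := exists_between hw
    exact eventually_lt_integral_of_eventually_whp_le hX hB hwv (h.eventually_const_le hvc)
  · obtain ⟨v, hcv, hvw⟩ := exists_between hw
    exact eventually_integral_lt_of_eventually_whp_le hX hB hvw (h.eventually_le_const hcv)

theorem le_liminf_integral_of_eventually_whp_le (hX : ∀ m, Measurable (X m))
    (hB : ∀ m ω, |X m ω| ≤ B) {w : ℝ} (h : ∀ᶠ x in whp P, w ≤ X x.1 x.2) :
    w ≤ liminf (fun m => ∫ ω, X m ω ∂(P m)) atTop := by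
  have hbdd : ∀ m, ∫ ω, X m ω ∂(P m) ≤ B := fun m =>
    (integral_mono (.of_bound (hX m).aestronglyMeasurable B (ae_of_all _ (hB m)))
      (integrable_const B) fun ω => (le_abs_self _).trans (hB m ω)).trans_eq (by simp)
  refine le_of_forall_lt_imp_le_of_dense fun v hv => le_liminf_of_le
    (isBoundedUnder_of ⟨B, hbdd⟩).isCoboundedUnder_ge ?_
  exact (eventually_lt_integral_of_eventually_whp_le hX hB hv h).mono fun m => le_of_lt

theorem consistent_of_tendsto_variance (hX : ∀ m, MemLp (X m) 2 (P m))
    (h : Tendsto (fun m => Var[X m; P m]) atTop (𝓝 0)) : Consistent P X := by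
  intro η hη
  have hlim : Tendsto (fun m => ENNReal.ofReal (Var[X m; P m] / η ^ 2)) atTop (𝓝 0) := by
    simpa using ENNReal.tendsto_ofReal (h.div_const (η ^ 2))
  refine tendsto_of_tendsto_of_tendsto_of_le_of_le tendsto_const_nhds hlim (fun _ => zero_le)
    fun m => ?_
  simpa only [sub_zero] using meas_ge_le_variance_div_sq (hX m) hη

end Whp

section CountLE

variable {ι : Type*} (s : Finset ι)

/-- Number of `i ∈ s` with `q i ≤ t`, the unnormalized empirical distribution function. -/
noncomputable def countLE (q : ι → ℝ) (t : ℝ) : ℕ :=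
  (s.filter fun i => q i ≤ t).card

theorem countLE_eq_sum (q : ι → ℝ) (t : ℝ) : countLE s q t = ∑ i ∈ s, if q i ≤ t then 1 else 0 :=
  Finset.card_filter _ _

theorem countLE_le_card (q : ι → ℝ) (t : ℝ) : countLE s q t ≤ s.card :=
  Finset.card_filter_le _ _

variable {s}

theorem countLE_mono_set {s' : Finset ι} (h : s ⊆ s') (q : ι → ℝ) (t : ℝ) :
    countLE s q t ≤ countLE s' q t :=
  Finset.card_le_card (Finset.filter_subset_filter _ h)

theorem countLE_mono {q q' : ι → ℝ} {t t' : ℝ} (hq : q' ≤ q) (ht : t ≤ t') :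
    countLE s q t ≤ countLE s q' t' :=
  Finset.card_le_card (Finset.monotone_filter_right s fun i _ hi => (hq i).trans (hi.trans ht))

theorem countLE_eq_card_of_le {q : ι → ℝ} {t : ℝ} (h : ∀ i, q i ≤ t) : countLE s q t = s.card :=
  congrArg Finset.card (Finset.filter_true_of_mem fun i _ => h i)

theorem countLE_add_compl [Fintype ι] [DecidableEq ι] (s : Finset ι) (q : ι → ℝ) (t : ℝ) :
    countLE s q t + countLE sᶜ q t = countLE Finset.univ q t := by
  simp only [countLE_eq_sum, Finset.sum_add_sum_compl]

theorem countLE_update [DecidableEq ι] {q : ι → ℝ} {i : ι} {t : ℝ} (ht : 0 ≤ t) (hi : q i ≤ t) :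
    countLE s (Function.update q i 0) t = countLE s q t := by
  refine congrArg Finset.card (Finset.filter_congr fun j _ => ?_)
  rcases eq_or_ne j i with rfl | hj
  · simp only [Function.update_self, ht, hi]
  · simp only [Function.update_of_ne hj]

theorem measurable_countLE {Ω : Type*} [MeasurableSpace Ω] {q : Ω → ι → ℝ} {t : Ω → ℝ}
    (hq : Measurable q) (ht : Measurable t) : Measurable fun ω => countLE s (q ω) (t ω) := by
  simp only [countLE_eq_sum]
  exact Finset.measurable_sum _ fun i _ => .ite
    (measurableSet_le ((measurable_pi_apply i).comp hq) ht) measurable_const measurable_const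

end CountLE

section StepUp

variable {m : ℕ} {q : Fin m → ℝ}

theorem empCDF_eq (s : Finset (Fin m)) (q : Fin m → ℝ) (t : ℝ) :
    empCDF s q t = (countLE s q t : ℝ) / (s.card : ℝ) := rfl

theorem measurable_empCDF (s : Finset (Fin m)) (t : ℝ) :
    Measurable fun q : Fin m → ℝ => empCDF s q t :=
  (measurable_from_nat.comp (measurable_countLE measurable_id measurable_const)).div_const _

theorem countLE_univ_le (q : Fin m → ℝ) (t : ℝ) : countLE Finset.univ q t ≤ m := by
  simpa using countLE_le_card Finset.univ q t

theorem orderStat_le_iff {i : ℕ} {t : ℝ} (hi : 1 ≤ i) (him : i ≤ m) :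
    orderStat q i ≤ t ↔ i ≤ countLE Finset.univ q t := by
  have hsort := Tuple.lt_card_le_iff_apply_le_of_monotone (a := t) (Tuple.monotone_sort q)
    (j := ⟨i - 1, by omega⟩)
  have hcard : Fintype.card {j // (q ∘ Tuple.sort q) j ≤ t} = countLE Finset.univ q t := by
    rw [countLE, ← Fintype.card_subtype]
    exact Fintype.card_congr ((Tuple.sort q).subtypeEquiv fun _ => Iff.rfl)
  rw [orderStat, dif_pos ⟨hi, him⟩, ← Function.comp_apply (f := q), ← hsort,
    ← Fintype.card_subtype, hcard]
  change i - 1 < _ ↔ _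
  omega

theorem numRej_le (c : ℕ → ℝ) (q : Fin m → ℝ) : numRej c q ≤ m := by
  classical
  exact Nat.findGreatest_le m

theorem numRej_le_countLE (c : ℕ → ℝ) (q : Fin m → ℝ) :
    numRej c q ≤ countLE Finset.univ q (c (numRej c q)) := by
  classical
  rcases Nat.eq_zero_or_pos (numRej c q) with h | h
  · exact h ▸ Nat.zero_le _
  · rw [← orderStat_le_iff h (numRej_le c q)]
    exact Nat.findGreatest_of_ne_zero (P := fun i => orderStat q i ≤ c i) rfl h.ne'

theorem le_numRej {c : ℕ → ℝ} {i : ℕ} (h : i ≤ countLE Finset.univ q (c i)) :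
    i ≤ numRej c q := by
  classical
  have him : i ≤ m := h.trans (countLE_univ_le _ _)
  rcases Nat.eq_zero_or_pos i with rfl | hi
  · exact Nat.zero_le _
  · exact Nat.le_findGreatest him ((orderStat_le_iff hi him).2 h)

theorem countLE_numRej {c : ℕ → ℝ} (hc : Monotone c) (q : Fin m → ℝ) :
    countLE Finset.univ q (c (numRej c q)) = numRej c q :=
  le_antisymm (le_numRej (countLE_mono le_rfl (hc (numRej_le_countLE c q))))
    (numRej_le_countLE c q)

theorem numRej_mono {c c' : ℕ → ℝ} {q' : Fin m → ℝ} (hc : ∀ i ≤ m, c i ≤ c' i) (hq : q' ≤ q) :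
    numRej c q ≤ numRej c' q' :=
  le_numRej ((numRej_le_countLE c q).trans (countLE_mono hq (hc _ (numRej_le c q))))

theorem numRej_update {c : ℕ → ℝ} (hc : Monotone c) (hc0 : 0 ≤ c 0) {i : Fin m} (hq : 0 ≤ q i)
    (h : q i ≤ c (numRej c (Function.update q i 0))) :
    numRej c (Function.update q i 0) = numRej c q := by
  refine le_antisymm (le_numRej ?_)
    (numRej_mono (fun _ _ => le_rfl) (update_le_self_iff.2 hq))
  rw [← countLE_update (hc0.trans (hc (Nat.zero_le _))) h]
  exact numRej_le_countLE _ _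

theorem measurable_numRej {Ω : Type*} [MeasurableSpace Ω] {c : Ω → ℕ → ℝ} {q : Ω → Fin m → ℝ}
    (hc : ∀ i, Measurable fun ω => c ω i) (hq : Measurable q) :
    Measurable fun ω => numRej (c ω) (q ω) := by
  classical
  have heq : (fun ω => numRej (c ω) (q ω)) = fun ω =>
      Nat.findGreatest (fun i => i ≤ countLE Finset.univ (q ω) (c ω i)) m := by
    funext ω
    refine le_antisymm (Nat.le_findGreatest (numRej_le _ _) (numRej_le_countLE _ _)) (le_numRej ?_)
    exact Nat.findGreatest_spec (P := fun i => i ≤ countLE Finset.univ (q ω) (c ω i))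
      (Nat.zero_le m) (Nat.zero_le _)
  rw [heq]
  exact measurable_findGreatest fun i _ =>
    measurableSet_le measurable_const (measurable_countLE hq (hc i))

theorem FDP_nonneg (c : ℕ → ℝ) (q : Fin m → ℝ) (I : Finset (Fin m)) : 0 ≤ FDP c q I := by
  unfold FDP
  positivity

theorem FDP_le_one {c : ℕ → ℝ} (hc : Monotone c) (q : Fin m → ℝ) (I : Finset (Fin m)) :
    FDP c q I ≤ 1 := by
  refine div_le_one_of_le₀ ?_ (Nat.cast_nonneg _)
  have hle := countLE_mono_set (Finset.subset_univ I) q (c (numRej c q))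
  rw [countLE_numRej hc] at hle
  exact_mod_cast hle

theorem FDP_congr {c c' : ℕ → ℝ} (q : Fin m → ℝ) (I : Finset (Fin m))
    (hc : ∀ i ≤ m, c i = c' i) : FDP c q I = FDP c' q I := by
  have hR : numRej c q = numRej c' q :=
    le_antisymm (numRej_mono (fun i hi => (hc i hi).le) le_rfl)
      (numRej_mono (fun i hi => (hc i hi).ge) le_rfl)
  rw [FDP, FDP, numFalseRej, numFalseRej, hR, hc _ (numRej_le c' q)]

theorem critAdaptive_monotone {α l M : ℝ} (hα : 0 ≤ α) (hM : 0 ≤ M) :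
    Monotone (critAdaptive α l M) := by
  intro i j hij
  unfold critAdaptive
  gcongr

theorem critAdaptive_zero {α l M : ℝ} (hl : 0 ≤ l) : critAdaptive α l M 0 = 0 := by
  simp [critAdaptive, hl]

/-- Rejections of the step-up test with critical values `min (i α / M q) l`. -/
noncomputable def adaptiveRej (α l : ℝ) (M : (Fin m → ℝ) → ℝ) (q : Fin m → ℝ) : ℕ :=
  numRej (critAdaptive α l (M q)) q

/-- Rejection threshold of the step-up test with critical values `min (i α / M q) l`. -/
noncomputable def adaptiveThr (α l : ℝ) (M : (Fin m → ℝ) → ℝ) (q : Fin m → ℝ) : ℝ :=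
  critAdaptive α l (M q) (adaptiveRej α l M q)

theorem adaptiveThr_le (α l : ℝ) (M : (Fin m → ℝ) → ℝ) (q : Fin m → ℝ) :
    adaptiveThr α l M q ≤ l :=
  min_le_right _ _

/-- Estimators of the number of true nulls for which the step-up test with critical values
`min (i α / M) l` admits exact moment formulas: `M` does not depend on the position of `p`-values
below `l`, and the critical values are positive and, at the number of rejections, uncapped. -/
structure NullEstimator (α l : ℝ) (M : (Fin m → ℝ) → ℝ) : Prop where
  alpha_pos : 0 < α
  cap_pos : 0 < l
  cap_le : l ≤ 1
  measurable : Measurable M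
  one_le : ∀ q, 1 ≤ M q
  le_apply : ∀ q, α / l * countLE Finset.univ q l ≤ M q
  apply_update : ∀ q i, q i ≤ l → M (Function.update q i 0) = M q

namespace NullEstimator

variable {α l : ℝ} {M : (Fin m → ℝ) → ℝ} (hM : NullEstimator α l M)
include hM

theorem pos (q : Fin m → ℝ) : 0 < M q := one_pos.trans_le (hM.one_le q)

theorem crit_monotone (q : Fin m → ℝ) : Monotone (critAdaptive α l (M q)) :=
  critAdaptive_monotone hM.alpha_pos.le (hM.pos q).le

theorem crit_nonneg (q : Fin m → ℝ) (i : ℕ) : 0 ≤ critAdaptive α l (M q) i :=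
  (critAdaptive_zero hM.cap_pos.le).ge.trans (hM.crit_monotone q (Nat.zero_le i))

theorem thr_mem_Icc (q : Fin m → ℝ) : adaptiveThr α l M q ∈ Set.Icc (0 : ℝ) 1 :=
  ⟨hM.crit_nonneg q _, (adaptiveThr_le _ _ _ q).trans hM.cap_le⟩

theorem cap_mem_Icc : l ∈ Set.Icc (0 : ℝ) 1 := ⟨hM.cap_pos.le, hM.cap_le⟩

theorem inv_mem_Icc (q : Fin m → ℝ) : (M q)⁻¹ ∈ Set.Icc (0 : ℝ) 1 :=
  ⟨inv_nonneg.2 (hM.pos q).le, inv_le_one_of_one_le₀ (hM.one_le q)⟩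

theorem countLE_thr (q : Fin m → ℝ) :
    countLE Finset.univ q (adaptiveThr α l M q) = adaptiveRej α l M q :=
  countLE_numRej (hM.crit_monotone q) q

theorem thr_eq (q : Fin m → ℝ) :
    adaptiveThr α l M q = (adaptiveRej α l M q : ℝ) / M q * α := by
  have hR : (adaptiveRej α l M q : ℝ) ≤ countLE Finset.univ q l := by
    rw [← hM.countLE_thr q]
    exact_mod_cast countLE_mono le_rfl (adaptiveThr_le _ _ _ q)
  have hα := hM.alpha_pos
  have hl := hM.cap_pos
  refine min_eq_left ?_
  rw [div_mul_eq_mul_div, div_le_iff₀ (hM.pos q)]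
  calc (adaptiveRej α l M q : ℝ) * α ≤ countLE Finset.univ q l * α := by gcongr
    _ = l * (α / l * countLE Finset.univ q l) := by field_simp
    _ ≤ l * M q := by gcongr; exact hM.le_apply q

theorem le_thr_update_iff {i : Fin m} (hq : 0 ≤ q i) :
    q i ≤ adaptiveThr α l M (Function.update q i 0) ↔ q i ≤ adaptiveThr α l M q := by
  suffices hiff : q i ≤ l → (q i ≤ adaptiveThr α l M (Function.update q i 0) ↔
      q i ≤ adaptiveThr α l M q) from
    ⟨fun hi => (hiff (hi.trans (adaptiveThr_le _ _ _ _))).1 hi,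
      fun hi => (hiff (hi.trans (adaptiveThr_le _ _ _ _))).2 hi⟩
  intro hil
  simp only [adaptiveThr, adaptiveRej, hM.apply_update q i hil]
  refine ⟨fun hi => ?_, fun hi => hi.trans (hM.crit_monotone q ?_)⟩
  · rwa [numRej_update (hM.crit_monotone q) (hM.crit_nonneg q 0) hq hi] at hi
  · exact numRej_mono (fun _ _ => le_rfl) (update_le_self_iff.2 hq)

theorem rej_update {i : Fin m} (hq : 0 ≤ q i) (hi : q i ≤ adaptiveThr α l M q) :
    adaptiveRej α l M (Function.update q i 0) = adaptiveRej α l M q := by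
  have hi' := (hM.le_thr_update_iff hq).2 hi
  have happly := hM.apply_update q i (hi.trans (adaptiveThr_le _ _ _ _))
  simp only [adaptiveThr, adaptiveRej, happly] at hi' ⊢
  exact numRej_update (hM.crit_monotone q) (hM.crit_nonneg q 0) hq hi'

theorem thr_update {i : Fin m} (hq : 0 ≤ q i) (hi : q i ≤ adaptiveThr α l M q) :
    adaptiveThr α l M (Function.update q i 0) = adaptiveThr α l M q := by
  rw [hM.thr_eq, hM.thr_eq, hM.rej_update hq hi,
    hM.apply_update q i (hi.trans (adaptiveThr_le _ _ _ _))]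

theorem rej_pos {i : Fin m} (hi : q i = 0) : 0 < adaptiveRej α l M q := by
  refine le_numRej (Finset.card_pos.2 ⟨i, Finset.mem_filter.2 ⟨Finset.mem_univ _, ?_⟩⟩)
  exact hi ▸ hM.crit_nonneg q _

theorem measurable_rej : Measurable fun q => adaptiveRej α l M q :=
  measurable_numRej (fun _ => ((measurable_const.div hM.measurable).mul_const α).min
    measurable_const) measurable_id

theorem measurable_rej_cast : Measurable fun q => (adaptiveRej α l M q : ℝ) :=
  measurable_from_nat.comp hM.measurable_rej

theorem measurable_thr : Measurable fun q => adaptiveThr α l M q := by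
  simp only [hM.thr_eq]
  exact (hM.measurable_rej_cast.div hM.measurable).mul_const α

end NullEstimator

end StepUp

section UniformNull

theorem indepFun_prodMk_of_indepFun {Ω A B C : Type*} [MeasurableSpace Ω] [MeasurableSpace A]
    [MeasurableSpace B] [MeasurableSpace C] {P : Measure Ω} [IsProbabilityMeasure P]
    {X : Ω → A} {Y : Ω → B} {Z : Ω → C} (hX : Measurable X) (hY : Measurable Y)
    (hZ : Measurable Z) (hXY : IndepFun X Y P) (hXYZ : IndepFun (fun ω => (X ω, Y ω)) Z P) :
    IndepFun X (fun ω => (Y ω, Z ω)) P := by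
  have hYZ : IndepFun Y Z P := hXYZ.comp measurable_snd measurable_id
  have : IsProbabilityMeasure (P.map X) := Measure.isProbabilityMeasure_map hX.aemeasurable
  have : IsProbabilityMeasure (P.map Y) := Measure.isProbabilityMeasure_map hY.aemeasurable
  have : IsProbabilityMeasure (P.map Z) := Measure.isProbabilityMeasure_map hZ.aemeasurable
  rw [indepFun_iff_map_prod_eq_prod_map_map (by fun_prop) (by fun_prop)] at hXY hXYZ hYZ ⊢
  rw [hYZ, ← Measure.prodAssoc_prod, ← hXY, ← hXYZ, Measure.map_map (by fun_prop) (by fun_prop)]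
  rfl

theorem integral_ite_le_mul_eq {Ω E : Type*} [MeasurableSpace Ω] [MeasurableSpace E]
    {P : Measure Ω} [IsProbabilityMeasure P] {X : Ω → ℝ} {Y : Ω → E} (hX : Measurable X)
    (hY : Measurable Y) (hXY : IndepFun X Y P)
    (hunif : ∀ x ∈ Set.Icc (0 : ℝ) 1, P.real {ω | X ω ≤ x} = x) {θ g : E → ℝ}
    (hθ : Measurable θ) (hθ01 : ∀ y, θ y ∈ Set.Icc (0 : ℝ) 1) (hg : Measurable g) {B : ℝ}
    (hB : ∀ y, |g y| ≤ B) :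
    ∫ ω, (if X ω ≤ θ (Y ω) then 1 else 0) * g (Y ω) ∂P = ∫ ω, θ (Y ω) * g (Y ω) ∂P := by
  have : IsProbabilityMeasure (P.map X) := Measure.isProbabilityMeasure_map hX.aemeasurable
  have : IsProbabilityMeasure (P.map Y) := Measure.isProbabilityMeasure_map hY.aemeasurable
  let F : ℝ × E → ℝ := fun z => (if z.1 ≤ θ z.2 then 1 else 0) * g z.2
  have hF : Measurable F :=
    (Measurable.ite (measurableSet_le measurable_fst (hθ.comp measurable_snd))
      measurable_const measurable_const).mul (hg.comp measurable_snd)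
  have hFB : ∀ z, ‖F z‖ ≤ B := fun z => by
    refine le_trans ?_ (hB z.2)
    simp only [F, ite_mul, one_mul, zero_mul]
    split_ifs <;> simp
  have hcdf : ∀ y, ∫ x, (if x ≤ θ y then (1 : ℝ) else 0) ∂P.map X = θ y := fun y => by
    have hind : (fun x => if x ≤ θ y then (1 : ℝ) else 0) = (Set.Iic (θ y)).indicator 1 := by
      funext x
      simp [Set.indicator_apply]
    rw [hind, integral_indicator_one measurableSet_Iic,
      map_measureReal_apply hX measurableSet_Iic]
    exact hunif _ (hθ01 y)
  calc ∫ ω, F (X ω, Y ω) ∂P = ∫ z, F z ∂((P.map X).prod (P.map Y)) := by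
        rw [← (indepFun_iff_map_prod_eq_prod_map_map hX.aemeasurable hY.aemeasurable).1 hXY,
          integral_map (hX.prodMk hY).aemeasurable hF.aestronglyMeasurable]
    _ = ∫ y, ∫ x, F (x, y) ∂P.map X ∂P.map Y :=
        integral_prod_symm _ (.of_bound hF.aestronglyMeasurable B (ae_of_all _ hFB))
    _ = ∫ y, θ y * g y ∂P.map Y := by simp only [F, integral_mul_const, hcdf]
    _ = ∫ ω, θ (Y ω) * g (Y ω) ∂P :=
        integral_map hY.aemeasurable (hθ.mul hg).aestronglyMeasurable

/-- The coordinate `q · i` of the random vector `q` behaves like the `p`-value of a true null: it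
is uniformly distributed and independent of the remaining coordinates, which are encoded by the
vector with `i`-th entry replaced by `0`. -/
structure IsUniformNull {Ω ι : Type*} [DecidableEq ι] [MeasurableSpace Ω] (P : Measure Ω)
    (q : Ω → ι → ℝ) (i : ι) : Prop where
  measurable : Measurable q
  nonneg : ∀ ω, 0 ≤ q ω i
  measureReal_le : ∀ x ∈ Set.Icc (0 : ℝ) 1, P.real {ω | q ω i ≤ x} = x
  indepFun_update : IndepFun (fun ω => q ω i) (fun ω => Function.update (q ω) i 0) P

namespace IsUniformNull

variable {Ω ι : Type*} [DecidableEq ι] [MeasurableSpace Ω] {P : Measure Ω} {q : Ω → ι → ℝ} {i : ι}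
  (h : IsUniformNull P q i)
include h

theorem measurable_apply : Measurable fun ω => q ω i := (measurable_pi_apply i).comp h.measurable

theorem measurable_update : Measurable fun ω => Function.update (q ω) i 0 :=
  measurable_update_left.comp h.measurable

theorem update {j : ι} (hj : IsUniformNull P q j) (hij : i ≠ j) :
    IsUniformNull P (fun ω => Function.update (q ω) i 0) j where
  measurable := h.measurable_update
  nonneg ω := by simpa only [Function.update_of_ne hij.symm] using hj.nonneg ω
  measureReal_le x hx := by simpa only [Function.update_of_ne hij.symm] using hj.measureReal_le x hx
  indepFun_update := by
    simp only [Function.update_of_ne hij.symm, Function.update_comm hij]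
    exact hj.indepFun_update.comp measurable_id measurable_update_left

theorem measureReal_update_mem_inter {S : Set (ι → ℝ)} (hS : MeasurableSet S) {T : Set ℝ}
    (hT : MeasurableSet T) (s : ℝ) :
    P.real {ω | q ω i ∈ T ∧ Function.update (q ω) i s ∈ S} =
      P.real {ω | q ω i ∈ T} * P.real {ω | Function.update (q ω) i s ∈ S} := by
  have hinter := h.indepFun_update.measure_inter_preimage_eq_mul T
    ((fun v => Function.update v i s) ⁻¹' S) hT (measurable_update_left hS)
  simpa only [Measure.real, ENNReal.toReal_mul, Set.preimage, Set.inter_def, Set.mem_ofPred_eq,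
    Function.update_idem] using congrArg ENNReal.toReal hinter

variable [IsProbabilityMeasure P]

theorem measureReal_gt {s : ℝ} (hs : s ∈ Set.Icc (0 : ℝ) 1) :
    P.real {ω | s < q ω i} = 1 - s := by
  have hcompl := probReal_compl_eq_one_sub (μ := P)
    (measurableSet_le h.measurable_apply (measurable_const (a := s)))
  simpa only [Set.compl_ofPred, not_le, h.measureReal_le s hs] using hcompl

theorem mul_measureReal_le_inter {s : ℝ} (hs : s ∈ Set.Icc (0 : ℝ) 1) {S : Set (ι → ℝ)}
    (hS : MeasurableSet S) (hup : IsUpperSet S) :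
    (1 - s) * P.real {ω | q ω ∈ S} ≤ P.real {ω | q ω ∈ S ∧ s < q ω i} := by
  have hle : P.real {ω | q ω ∈ S ∧ q ω i ≤ s} ≤
      s * P.real {ω | Function.update (q ω) i s ∈ S} := by
    have hprod := h.measureReal_update_mem_inter hS (measurableSet_Iic (a := s)) s
    simp only [Set.mem_Iic, h.measureReal_le s hs] at hprod
    rw [← hprod]
    exact measureReal_mono fun ω hω => ⟨hω.2, hup (le_update_self_iff.2 hω.2) hω.1⟩
  have hgt : (1 - s) * P.real {ω | Function.update (q ω) i s ∈ S} ≤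
      P.real {ω | q ω ∈ S ∧ s < q ω i} := by
    have hprod := h.measureReal_update_mem_inter hS (measurableSet_Ioi (a := s)) s
    simp only [Set.mem_Ioi, h.measureReal_gt hs] at hprod
    rw [← hprod]
    exact measureReal_mono fun ω hω => ⟨hup (update_le_self_iff.2 hω.1.le) hω.2, hω.1⟩
  have hsplit : P.real {ω | q ω ∈ S} =
      P.real {ω | q ω ∈ S ∧ q ω i ≤ s} + P.real {ω | q ω ∈ S ∧ s < q ω i} := by
    rw [← measureReal_inter_add_sdiff (μ := P) (s := {ω | q ω ∈ S})
      (measurableSet_le h.measurable_apply (measurable_const (a := s)))]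
    simp only [Set.inter_def, Set.sdiff_eq, Set.compl_ofPred, Set.mem_ofPred_eq, not_le]
  rw [hsplit]
  nlinarith [hs.1, hs.2]

omit h in
theorem pow_mul_measureReal_le_inter {s : ℝ} (hs : s ∈ Set.Icc (0 : ℝ) 1) {S : Set (ι → ℝ)}
    (hS : MeasurableSet S) (hup : IsUpperSet S) {J : Finset ι}
    (hJ : ∀ j ∈ J, IsUniformNull P q j) :
    (1 - s) ^ J.card * P.real {ω | q ω ∈ S} ≤ P.real {ω | q ω ∈ S ∧ ∀ j ∈ J, s < q ω j} := by
  induction J using Finset.induction_on with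
  | empty => simp
  | insert i J hi ih =>
    rw [Finset.forall_mem_insert] at hJ
    let S' : Set (ι → ℝ) := S ∩ ⋂ j ∈ J, {v | s < v j}
    have hS' : MeasurableSet S' := hS.inter <| .biInter J.countable_toSet fun j _ =>
      measurableSet_lt measurable_const (measurable_pi_apply j)
    have hup' : IsUpperSet S' := hup.inter <| isUpperSet_iInter₂ fun j _ v v' hv hj =>
      lt_of_lt_of_le hj (hv j)
    have hS'_iff : ∀ v, v ∈ S' ↔ v ∈ S ∧ ∀ j ∈ J, s < v j := fun v => by simp [S']
    calc (1 - s) ^ (insert i J).card * P.real {ω | q ω ∈ S}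
        = (1 - s) * ((1 - s) ^ J.card * P.real {ω | q ω ∈ S}) := by
          rw [Finset.card_insert_of_notMem hi, pow_succ', mul_assoc]
      _ ≤ (1 - s) * P.real {ω | q ω ∈ S'} := by
          simp only [hS'_iff]
          exact mul_le_mul_of_nonneg_left (ih hJ.2) (sub_nonneg.2 hs.2)
      _ ≤ P.real {ω | q ω ∈ S' ∧ s < q ω i} := hJ.1.mul_measureReal_le_inter hs hS' hup'
      _ = P.real {ω | q ω ∈ S ∧ ∀ j ∈ insert i J, s < q ω j} := by
          simp only [hS'_iff, Finset.forall_mem_insert, and_assoc, and_comm (a := ∀ j ∈ J, _)]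

end IsUniformNull

theorem measure_le_abs_countLE_sub_le {Ω ι : Type*} [MeasurableSpace Ω] {P : Measure Ω}
    [IsProbabilityMeasure P] {q : Ω → ι → ℝ} {J : Finset ι}
    (hq : ∀ i ∈ J, Measurable fun ω => q ω i)
    (hindep : (J : Set ι).Pairwise fun i j => IndepFun (fun ω => q ω i) (fun ω => q ω j) P)
    {t u : ℝ} (hu : ∀ i ∈ J, P.real {ω | q ω i ≤ t} = u) {x : ℝ} (hx : 0 < x) :
    P {ω | x ≤ |(countLE J (q ω) t : ℝ) - J.card * u|} ≤ ENNReal.ofReal (J.card * u / x ^ 2) := by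
  let X : ι → Ω → ℝ := fun i => {ω | q ω i ≤ t}.indicator 1
  have hmeas : ∀ i ∈ J, MeasurableSet {ω | q ω i ≤ t} := fun i hi =>
    measurableSet_le (hq i hi) measurable_const
  have hXL : ∀ i ∈ J, MemLp (X i) 2 P := fun i hi =>
    (memLp_const 1).indicator (hmeas i hi)
  have hmean : ∀ i ∈ J, P[X i] = u := fun i hi =>
    (integral_indicator_one (hmeas i hi)).trans (hu i hi)
  have hvar : ∀ i ∈ J, Var[X i; P] ≤ u := fun i hi => by
    refine (variance_le_expectation_sq (hXL i hi).1).trans_eq ?_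
    rw [← hmean i hi]
    exact congrArg _ (funext fun ω => by by_cases hω : q ω i ≤ t <;> simp [X, hω])
  have hpair : (J : Set ι).Pairwise fun i j => IndepFun (X i) (X j) P := fun i hi j hj hij => by
    have hind : Measurable ((Set.Iic t).indicator (1 : ℝ → ℝ)) :=
      measurable_one.indicator measurableSet_Iic
    exact (hindep hi hj hij).comp hind hind
  have hcount : ∀ ω, (countLE J (q ω) t : ℝ) = (∑ i ∈ J, X i) ω := fun ω => by
    simp [countLE_eq_sum, X, Finset.sum_apply, Set.indicator_apply]
  have hsum : P[∑ i ∈ J, X i] = J.card * u := by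
    simp only [Finset.sum_apply]
    rw [integral_finsetSum _ fun i hi => (hXL i hi).integrable one_le_two,
      Finset.sum_congr rfl hmean, Finset.sum_const, nsmul_eq_mul]
  simp only [hcount, ← hsum]
  refine (meas_ge_le_variance_div_sq (memLp_finsetSum' J hXL) hx).trans
    (ENNReal.ofReal_le_ofReal ?_)
  rw [IndepFun.variance_sum hXL hpair, hsum, ← nsmul_eq_mul]
  exact div_le_div_of_nonneg_right (Finset.sum_le_card_nsmul J _ u hvar) (sq_nonneg x)

end UniformNull

namespace BasicIndependence

variable {Ω : Type*} [MeasurableSpace Ω] {P : Measure Ω} {m : ℕ} {p : Ω → Fin m → ℝ}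
  {I : Finset (Fin m)} (h : BasicIndependence P p I)
include h

theorem measurable_fun : Measurable p := measurable_pi_lambda _ h.measurable

theorem measureReal_le {i : Fin m} (hi : i ∈ I) {x : ℝ} (hx : x ∈ Set.Icc (0 : ℝ) 1) :
    P.real {ω | p ω i ≤ x} = x := by
  rw [Measure.real, h.uniform_true i hi x hx, ENNReal.toReal_ofReal hx.1]

theorem indepFun_prod_others [IsProbabilityMeasure P] (i : {i // i ∈ I}) :
    IndepFun (fun ω => p ω i)
      (fun ω => (fun j : ({i}ᶜ : Finset {i // i ∈ I}) => p ω j, fun j : {j // j ∉ I} => p ω j))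
      P := by
  have hm := h.measurable
  have htrue : IndepFun (fun ω => p ω i) (fun ω (j : ({i}ᶜ : Finset {i // i ∈ I})) => p ω j) P :=
    (h.indep_true.indepFun_finset {i} {i}ᶜ disjoint_compl_right fun j => h.measurable j).comp
      (measurable_pi_apply (⟨i, Finset.mem_singleton_self i⟩ : ({i} : Finset {i // i ∈ I})))
      measurable_id
  refine indepFun_prodMk_of_indepFun (by fun_prop) (by fun_prop) (by fun_prop) htrue ?_
  exact h.indep_true_false.comp
    (φ := fun f => (f i, fun j : ({i}ᶜ : Finset {i // i ∈ I}) => f j)) (by fun_prop) measurable_id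

theorem isUniformNull [IsProbabilityMeasure P] {i : Fin m} (hi : i ∈ I) :
    IsUniformNull P p i where
  measurable := h.measurable_fun
  nonneg ω := (h.mem_Icc ω i).1
  measureReal_le _ := h.measureReal_le hi
  indepFun_update := by
    let others : (({⟨i, hi⟩}ᶜ : Finset {i // i ∈ I}) → ℝ) × ({j // j ∉ I} → ℝ) → Fin m → ℝ :=
      fun f j => if hj : j = i then 0 else
        if hjI : j ∈ I then f.1 ⟨⟨j, hjI⟩, by simpa using hj⟩ else f.2 ⟨j, hjI⟩
    have hothers : Measurable others := measurable_pi_lambda _ fun j => by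
      by_cases hj : j = i
      · simp only [others, hj, dite_true, measurable_const]
      · by_cases hjI : j ∈ I <;> simp only [others, hj, hjI, dite_true, dite_false] <;> fun_prop
    refine ((h.indepFun_prod_others ⟨i, hi⟩).comp measurable_id hothers).congr .rfl
      (.of_forall fun ω => funext fun j => ?_)
    rcases eq_or_ne j i with rfl | hj
    · simp [others]
    · by_cases hjI : j ∈ I <;> simp [others, hj, hjI]

theorem measure_le_abs_countLE_sub_le [IsProbabilityMeasure P] {t : ℝ}
    (ht : t ∈ Set.Icc (0 : ℝ) 1) {x : ℝ} (hx : 0 < x) :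
    P {ω | x ≤ |(countLE I (p ω) t : ℝ) - I.card * t|} ≤ ENNReal.ofReal (I.card * t / x ^ 2) :=
  MultipleTesting.measure_le_abs_countLE_sub_le (fun i _ => h.measurable i)
    (fun _ hi _ hj hij => h.indep_true.indepFun (i := ⟨_, hi⟩) (j := ⟨_, hj⟩)
      (fun hij' => hij (congrArg Subtype.val hij')))
    (fun _ hi => h.measureReal_le hi ht) hx

end BasicIndependence

section Moments

theorem abs_le_one_of_mem_Icc {a : ℝ} (ha : a ∈ Set.Icc (0 : ℝ) 1) : |a| ≤ 1 :=
  abs_le.2 ⟨neg_one_lt_zero.le.trans ha.1, ha.2⟩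

theorem integrable_of_mem_Icc {Ω : Type*} [MeasurableSpace Ω] {P : Measure Ω}
    [IsFiniteMeasure P] {X : Ω → ℝ} (hX : Measurable X) (h01 : ∀ ω, X ω ∈ Set.Icc (0 : ℝ) 1) :
    Integrable X P :=
  .of_bound hX.aestronglyMeasurable 1 (ae_of_all _ fun ω => abs_le_one_of_mem_Icc (h01 ω))

/-- A threshold `θ` and a weight `w` which do not change when an entry below the threshold is
lowered to `0`, and whose product is then `c u`. The false discovery proportion of an adaptive test
and its estimated counterpart `nullFraction` are both sums of such weights over the true nulls that
fall below the threshold, with the same `u`. -/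
structure ThresholdWeight {ι : Type*} [DecidableEq ι] (c : ℝ) (u θ w : (ι → ℝ) → ℝ) : Prop where
  measurable_factor : Measurable u
  measurable_thr : Measurable θ
  measurable_weight : Measurable w
  factor_mem_Icc : ∀ q, u q ∈ Set.Icc (0 : ℝ) 1
  thr_mem_Icc : ∀ q, θ q ∈ Set.Icc (0 : ℝ) 1
  weight_mem_Icc : ∀ q, w q ∈ Set.Icc (0 : ℝ) 1
  le_thr_update_iff : ∀ {q i}, 0 ≤ q i → (q i ≤ θ (Function.update q i 0) ↔ q i ≤ θ q)
  factor_update : ∀ {q i}, 0 ≤ q i → q i ≤ θ q → u (Function.update q i 0) = u q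
  thr_update : ∀ {q i}, 0 ≤ q i → q i ≤ θ q → θ (Function.update q i 0) = θ q
  weight_update : ∀ {q i}, 0 ≤ q i → q i ≤ θ q → w (Function.update q i 0) = w q
  thr_mul_weight : ∀ {q i}, q i = 0 → θ q * w q = c * u q

/-- The weight `w q` if the `i`-th entry is at most the threshold `θ q`, and `0` otherwise. -/
noncomputable def thrTerm {ι : Type*} (θ w : (ι → ℝ) → ℝ) (i : ι) (q : ι → ℝ) : ℝ :=
  if q i ≤ θ q then w q else 0

theorem sum_thrTerm {ι : Type*} (θ w : (ι → ℝ) → ℝ) (I : Finset ι) (q : ι → ℝ) :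
    ∑ i ∈ I, thrTerm θ w i q = countLE I q (θ q) * w q := by
  simp only [thrTerm, countLE, ← Finset.sum_filter, Finset.sum_const, nsmul_eq_mul]

namespace ThresholdWeight

variable {ι : Type*} [DecidableEq ι] {c : ℝ} {u θ w : (ι → ℝ) → ℝ} (hw : ThresholdWeight c u θ w)
include hw

theorem term_mem_Icc (i : ι) (q : ι → ℝ) : thrTerm θ w i q ∈ Set.Icc (0 : ℝ) 1 := by
  unfold thrTerm
  split_ifs
  exacts [hw.weight_mem_Icc q, Set.left_mem_Icc.2 zero_le_one]

theorem measurable_term (i : ι) : Measurable (thrTerm θ w i) :=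
  .ite (measurableSet_le (measurable_pi_apply i) hw.measurable_thr) hw.measurable_weight
    measurable_const

theorem term_mul_eq_update {q : ι → ℝ} {i : ι} (hq : 0 ≤ q i) {F : (ι → ℝ) → ℝ}
    (hF : q i ≤ θ q → F (Function.update q i 0) = F q) :
    thrTerm θ w i q * F q = (if q i ≤ θ (Function.update q i 0) then 1 else 0) *
      (w (Function.update q i 0) * F (Function.update q i 0)) := by
  by_cases hi : q i ≤ θ q
  · rw [thrTerm, if_pos hi, if_pos ((hw.le_thr_update_iff hq).2 hi), one_mul,
      hw.weight_update hq hi, hF hi]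
  · rw [thrTerm, if_neg hi, if_neg (mt (hw.le_thr_update_iff hq).1 hi), zero_mul, zero_mul]

variable {Ω : Type*} [MeasurableSpace Ω] {P : Measure Ω} [IsProbabilityMeasure P] {q : Ω → ι → ℝ}

theorem integrable_term_mul_term (hq : Measurable q) (i j : ι) :
    Integrable (fun ω => thrTerm θ w i (q ω) * thrTerm θ w j (q ω)) P :=
  integrable_of_mem_Icc (((hw.measurable_term i).comp hq).mul ((hw.measurable_term j).comp hq))
    fun ω => unitInterval.mul_mem (hw.term_mem_Icc i (q ω)) (hw.term_mem_Icc j (q ω))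

theorem integral_term_mul {i : ι} (hi : IsUniformNull P q i) {F : (ι → ℝ) → ℝ}
    (hF : Measurable F) (hF01 : ∀ v, F v ∈ Set.Icc (0 : ℝ) 1)
    (hFi : ∀ v, 0 ≤ v i → v i ≤ θ v → F (Function.update v i 0) = F v) :
    ∫ ω, thrTerm θ w i (q ω) * F (q ω) ∂P =
      c * ∫ ω, u (Function.update (q ω) i 0) * F (Function.update (q ω) i 0) ∂P := by
  have hwF : ∀ v, w v * F v ∈ Set.Icc (0 : ℝ) 1 := fun v =>
    unitInterval.mul_mem (hw.weight_mem_Icc v) (hF01 v)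
  calc ∫ ω, thrTerm θ w i (q ω) * F (q ω) ∂P
      = ∫ ω, (if q ω i ≤ θ (Function.update (q ω) i 0) then 1 else 0) *
          (w (Function.update (q ω) i 0) * F (Function.update (q ω) i 0)) ∂P := by
        simp only [hw.term_mul_eq_update (hi.nonneg _) (hFi _ (hi.nonneg _))]
    _ = ∫ ω, θ (Function.update (q ω) i 0) *
          (w (Function.update (q ω) i 0) * F (Function.update (q ω) i 0)) ∂P :=
        integral_ite_le_mul_eq hi.measurable_apply hi.measurable_update hi.indepFun_update
          hi.measureReal_le hw.measurable_thr hw.thr_mem_Icc (hw.measurable_weight.mul hF)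
          fun v => abs_le_one_of_mem_Icc (hwF v)
    _ = c * ∫ ω, u (Function.update (q ω) i 0) * F (Function.update (q ω) i 0) ∂P := by
        simp only [← mul_assoc, hw.thr_mul_weight (Function.update_self i 0 _)]
        simp only [mul_assoc, integral_const_mul]

theorem integral_term {i : ι} (hi : IsUniformNull P q i) :
    ∫ ω, thrTerm θ w i (q ω) ∂P = c * ∫ ω, u (Function.update (q ω) i 0) ∂P := by
  simpa only [mul_one] using hw.integral_term_mul hi (F := fun _ => 1) measurable_const
    (fun _ => Set.right_mem_Icc.2 zero_le_one) fun _ _ _ => rfl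

theorem integral_term_mul_term {i j : ι} (hij : i ≠ j) (hi : IsUniformNull P q i)
    (hj : IsUniformNull P q j) :
    ∫ ω, thrTerm θ w i (q ω) * thrTerm θ w j (q ω) ∂P =
      c ^ 2 * ∫ ω, u (Function.update (Function.update (q ω) i 0) j 0) ^ 2 ∂P := by
  have hterm : ∀ v, 0 ≤ v i → v i ≤ θ v →
      thrTerm θ w j (Function.update v i 0) = thrTerm θ w j v := fun v h0 hle => by
    simp only [thrTerm, Function.update_of_ne hij.symm, hw.thr_update h0 hle,
      hw.weight_update h0 hle]
  calc ∫ ω, thrTerm θ w i (q ω) * thrTerm θ w j (q ω) ∂P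
      = c * ∫ ω, thrTerm θ w j (Function.update (q ω) i 0) * u (Function.update (q ω) i 0) ∂P := by
        simp only [hw.integral_term_mul hi (hw.measurable_term j) (hw.term_mem_Icc j) hterm,
          mul_comm]
    _ = c ^ 2 * ∫ ω, u (Function.update (Function.update (q ω) i 0) j 0) ^ 2 ∂P := by
        simp only [hw.integral_term_mul (hi.update hj hij) hw.measurable_factor hw.factor_mem_Icc
          fun _ => hw.factor_update, sq, mul_assoc]

end ThresholdWeight

variable {m : ℕ} {α l : ℝ} {M : (Fin m → ℝ) → ℝ}

variable (α l M) in
/-- The fraction `α V(l) / (l M)`, which has the same mean as the false discovery proportion. -/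
noncomputable def nullFraction (I : Finset (Fin m)) (q : Fin m → ℝ) : ℝ :=
  α / l * ((countLE I q l : ℝ) / M q)

variable (α l M) in
/-- Contribution of the `i`-th `p`-value to the false discovery proportion. -/
noncomputable abbrev rejTerm : Fin m → (Fin m → ℝ) → ℝ :=
  thrTerm (adaptiveThr α l M) fun q => (adaptiveRej α l M q : ℝ)⁻¹

variable (l M) in
/-- Contribution of the `i`-th `p`-value to `V(l) / M`. -/
noncomputable abbrev nullTerm : Fin m → (Fin m → ℝ) → ℝ :=
  thrTerm (fun _ => l) fun q => (M q)⁻¹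

theorem FDP_critAdaptive_eq_sum (I : Finset (Fin m)) (q : Fin m → ℝ) :
    FDP (critAdaptive α l (M q)) q I = ∑ i ∈ I, rejTerm α l M i q := by
  rw [sum_thrTerm, ← div_eq_mul_inv]
  rfl

theorem nullFraction_eq_sum (I : Finset (Fin m)) (q : Fin m → ℝ) :
    nullFraction α l M I q = α / l * ∑ i ∈ I, nullTerm l M i q := by
  rw [sum_thrTerm, nullFraction, div_eq_mul_inv (countLE I q l : ℝ)]

theorem sq_sum_eq_sum_sq_add_sum_offDiag {ι : Type*} (I : Finset ι) (f : ι → ℝ) :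
    (∑ i ∈ I, f i) ^ 2 = ∑ i ∈ I, f i ^ 2 + ∑ x ∈ I.offDiag, f x.1 * f x.2 := by
  classical
  rw [sq, Finset.sum_mul_sum, ← Finset.sum_product', ← Finset.diag_union_offDiag,
    Finset.sum_union (Finset.disjoint_diag_offDiag I), Finset.sum_diag]
  simp only [sq]

namespace NullEstimator

variable (hM : NullEstimator α l M)
include hM

theorem thresholdWeight_rejTerm : ThresholdWeight α (fun q => (M q)⁻¹) (adaptiveThr α l M)
    fun q => (adaptiveRej α l M q : ℝ)⁻¹ where
  measurable_factor := hM.measurable.inv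
  measurable_thr := hM.measurable_thr
  measurable_weight := hM.measurable_rej_cast.inv
  factor_mem_Icc := hM.inv_mem_Icc
  thr_mem_Icc := hM.thr_mem_Icc
  weight_mem_Icc _ := ⟨by positivity, Nat.cast_inv_le_one _⟩
  le_thr_update_iff := hM.le_thr_update_iff
  factor_update _ hi := congrArg _ (hM.apply_update _ _ (hi.trans (adaptiveThr_le _ _ _ _)))
  thr_update := hM.thr_update
  weight_update h0 hi := by rw [hM.rej_update h0 hi]
  thr_mul_weight {q i} hi := by
    have hR : (adaptiveRej α l M q : ℝ) ≠ 0 := Nat.cast_ne_zero.2 (hM.rej_pos hi).ne'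
    rw [hM.thr_eq]
    field_simp

theorem thresholdWeight_nullTerm :
    ThresholdWeight l (fun q => (M q)⁻¹) (fun _ => l) fun q => (M q)⁻¹ where
  measurable_factor := hM.measurable.inv
  measurable_thr := measurable_const
  measurable_weight := hM.measurable.inv
  factor_mem_Icc := hM.inv_mem_Icc
  thr_mem_Icc _ := hM.cap_mem_Icc
  weight_mem_Icc := hM.inv_mem_Icc
  le_thr_update_iff _ := Iff.rfl
  factor_update _ hi := congrArg _ (hM.apply_update _ _ hi)
  thr_update _ _ := rfl
  weight_update _ hi := congrArg _ (hM.apply_update _ _ hi)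
  thr_mul_weight _ := rfl

theorem measurable_nullFraction (I : Finset (Fin m)) : Measurable (nullFraction α l M I) :=
  ((measurable_from_nat.comp (measurable_countLE measurable_id measurable_const)).div
    hM.measurable).const_mul _

theorem nullFraction_mem_Icc (I : Finset (Fin m)) (q : Fin m → ℝ) :
    nullFraction α l M I q ∈ Set.Icc (0 : ℝ) 1 := by
  have hα := hM.alpha_pos
  have hl := hM.cap_pos
  have hpos := hM.pos q
  have hcount : (countLE I q l : ℝ) ≤ countLE Finset.univ q l := by
    exact_mod_cast countLE_mono_set (Finset.subset_univ I) q l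
  refine ⟨by unfold nullFraction; positivity, ?_⟩
  rw [nullFraction, ← mul_div_assoc, div_le_one hpos]
  exact (mul_le_mul_of_nonneg_left hcount (by positivity)).trans (hM.le_apply q)

theorem FDP_mem_Icc (I : Finset (Fin m)) (q : Fin m → ℝ) :
    FDP (critAdaptive α l (M q)) q I ∈ Set.Icc (0 : ℝ) 1 :=
  ⟨FDP_nonneg _ _ _, FDP_le_one (hM.crit_monotone q) q I⟩

theorem measurable_FDP (I : Finset (Fin m)) :
    Measurable fun q => FDP (critAdaptive α l (M q)) q I := by
  simp only [FDP_critAdaptive_eq_sum]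
  exact Finset.measurable_sum _ fun i _ => hM.thresholdWeight_rejTerm.measurable_term i

theorem FDP_sq_le (I : Finset (Fin m)) (q : Fin m → ℝ) :
    FDP (critAdaptive α l (M q)) q I ^ 2 ≤
      (adaptiveRej α l M q : ℝ)⁻¹ + ∑ x ∈ I.offDiag, rejTerm α l M x.1 q * rejTerm α l M x.2 q := by
  have hdiag : ∑ i ∈ I, rejTerm α l M i q ^ 2 ≤ (adaptiveRej α l M q : ℝ)⁻¹ :=
    calc ∑ i ∈ I, rejTerm α l M i q ^ 2
        = FDP (critAdaptive α l (M q)) q I * (adaptiveRej α l M q : ℝ)⁻¹ := by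
          rw [FDP_critAdaptive_eq_sum, Finset.sum_mul]
          refine Finset.sum_congr rfl fun i _ => ?_
          simp only [rejTerm, thrTerm]
          split_ifs <;> ring
      _ ≤ (adaptiveRej α l M q : ℝ)⁻¹ :=
          mul_le_of_le_one_left (by positivity) (hM.FDP_mem_Icc I q).2
  rw [FDP_critAdaptive_eq_sum, sq_sum_eq_sum_sq_add_sum_offDiag]
  exact add_le_add_left hdiag _

omit hM in
theorem sum_offDiag_nullTerm_le (I : Finset (Fin m)) (q : Fin m → ℝ) :
    (α / l) ^ 2 * ∑ x ∈ I.offDiag, nullTerm l M x.1 q * nullTerm l M x.2 q ≤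
      nullFraction α l M I q ^ 2 := by
  rw [nullFraction_eq_sum, mul_pow, sq_sum_eq_sum_sq_add_sum_offDiag]
  exact mul_le_mul_of_nonneg_left
    (le_add_of_nonneg_left (Finset.sum_nonneg fun i _ => sq_nonneg _)) (sq_nonneg _)

variable {Ω : Type*} [MeasurableSpace Ω] {P : Measure Ω} [IsProbabilityMeasure P]
  {p : Ω → Fin m → ℝ} {I : Finset (Fin m)}

theorem integral_rejTerm {i : Fin m} (hi : IsUniformNull P p i) :
    ∫ ω, rejTerm α l M i (p ω) ∂P = α / l * ∫ ω, nullTerm l M i (p ω) ∂P := by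
  have hl := hM.cap_pos
  rw [hM.thresholdWeight_rejTerm.integral_term hi, hM.thresholdWeight_nullTerm.integral_term hi]
  field_simp

theorem integral_rejTerm_mul_rejTerm {i j : Fin m} (hij : i ≠ j) (hi : IsUniformNull P p i)
    (hj : IsUniformNull P p j) :
    ∫ ω, rejTerm α l M i (p ω) * rejTerm α l M j (p ω) ∂P =
      (α / l) ^ 2 * ∫ ω, nullTerm l M i (p ω) * nullTerm l M j (p ω) ∂P := by
  have hl := hM.cap_pos
  rw [hM.thresholdWeight_rejTerm.integral_term_mul_term hij hi hj,
    hM.thresholdWeight_nullTerm.integral_term_mul_term hij hi hj]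
  field_simp

theorem integral_FDP (h : BasicIndependence P p I) :
    ∫ ω, FDP (critAdaptive α l (M (p ω))) (p ω) I ∂P = ∫ ω, nullFraction α l M I (p ω) ∂P := by
  have hT := hM.thresholdWeight_rejTerm
  have hN := hM.thresholdWeight_nullTerm
  simp only [nullFraction_eq_sum, FDP_critAdaptive_eq_sum]
  rw [integral_const_mul, integral_finsetSum, integral_finsetSum, Finset.mul_sum]
  · exact Finset.sum_congr rfl fun i hi => hM.integral_rejTerm (h.isUniformNull hi)
  · exact fun i _ => integrable_of_mem_Icc ((hN.measurable_term i).comp h.measurable_fun)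
      fun ω => hN.term_mem_Icc i (p ω)
  · exact fun i _ => integrable_of_mem_Icc ((hT.measurable_term i).comp h.measurable_fun)
      fun ω => hT.term_mem_Icc i (p ω)

theorem integral_FDP_sq_le (h : BasicIndependence P p I) :
    ∫ ω, FDP (critAdaptive α l (M (p ω))) (p ω) I ^ 2 ∂P ≤
      ∫ ω, (adaptiveRej α l M (p ω) : ℝ)⁻¹ ∂P + ∫ ω, nullFraction α l M I (p ω) ^ 2 ∂P := by
  have hp := h.measurable_fun
  have hoffDiag : ∫ ω, ∑ x ∈ I.offDiag, rejTerm α l M x.1 (p ω) * rejTerm α l M x.2 (p ω) ∂P =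
      ∫ ω, (α / l) ^ 2 * ∑ x ∈ I.offDiag, nullTerm l M x.1 (p ω) * nullTerm l M x.2 (p ω) ∂P := by
    rw [integral_const_mul,
      integral_finsetSum _ fun x _ =>
        hM.thresholdWeight_rejTerm.integrable_term_mul_term hp x.1 x.2,
      integral_finsetSum _ fun x _ =>
        hM.thresholdWeight_nullTerm.integrable_term_mul_term hp x.1 x.2, Finset.mul_sum]
    refine Finset.sum_congr rfl fun x hx => ?_
    obtain ⟨hi, hj, hij⟩ := Finset.mem_offDiag.1 hx
    exact hM.integral_rejTerm_mul_rejTerm hij (h.isUniformNull hi) (h.isUniformNull hj)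
  have hT : Integrable (fun ω => ∑ x ∈ I.offDiag,
      rejTerm α l M x.1 (p ω) * rejTerm α l M x.2 (p ω)) P :=
    integrable_finsetSum _ fun x _ => hM.thresholdWeight_rejTerm.integrable_term_mul_term hp x.1 x.2
  have hN : Integrable (fun ω => (α / l) ^ 2 * ∑ x ∈ I.offDiag,
      nullTerm l M x.1 (p ω) * nullTerm l M x.2 (p ω)) P :=
    (integrable_finsetSum _ fun x _ =>
      hM.thresholdWeight_nullTerm.integrable_term_mul_term hp x.1 x.2).const_mul _
  have hR : Integrable (fun ω => (adaptiveRej α l M (p ω) : ℝ)⁻¹) P :=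
    integrable_of_mem_Icc (hM.measurable_rej_cast.comp hp).inv
      fun ω => hM.thresholdWeight_rejTerm.weight_mem_Icc (p ω)
  have hFDP : Integrable (fun ω => FDP (critAdaptive α l (M (p ω))) (p ω) I ^ 2) P :=
    integrable_of_mem_Icc (((hM.measurable_FDP I).comp hp).pow_const 2)
      fun ω => ⟨sq_nonneg _, pow_le_one₀ (hM.FDP_mem_Icc I (p ω)).1 (hM.FDP_mem_Icc I (p ω)).2⟩
  have hW : Integrable (fun ω => nullFraction α l M I (p ω) ^ 2) P :=
    integrable_of_mem_Icc (((hM.measurable_nullFraction I).comp hp).pow_const 2)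
      fun ω => ⟨sq_nonneg _, pow_le_one₀ (hM.nullFraction_mem_Icc I (p ω)).1
        (hM.nullFraction_mem_Icc I (p ω)).2⟩
  calc ∫ ω, FDP (critAdaptive α l (M (p ω))) (p ω) I ^ 2 ∂P
      ≤ ∫ ω, ((adaptiveRej α l M (p ω) : ℝ)⁻¹ +
          ∑ x ∈ I.offDiag, rejTerm α l M x.1 (p ω) * rejTerm α l M x.2 (p ω)) ∂P :=
        integral_mono hFDP (hR.add hT) fun ω => hM.FDP_sq_le I (p ω)
    _ ≤ ∫ ω, (adaptiveRej α l M (p ω) : ℝ)⁻¹ ∂P + ∫ ω, nullFraction α l M I (p ω) ^ 2 ∂P := by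
        rw [integral_add hR hT, hoffDiag]
        exact add_le_add_right (integral_mono hN hW fun ω => sum_offDiag_nullTerm_le I (p ω)) _

theorem memLp_FDP (h : BasicIndependence P p I) :
    MemLp (fun ω => FDP (critAdaptive α l (M (p ω))) (p ω) I) 2 P :=
  .of_bound ((hM.measurable_FDP I).comp h.measurable_fun).aestronglyMeasurable 1
    (ae_of_all _ fun ω => abs_le_one_of_mem_Icc (hM.FDP_mem_Icc I (p ω)))

theorem variance_FDP_le (h : BasicIndependence P p I) :
    Var[fun ω => FDP (critAdaptive α l (M (p ω))) (p ω) I; P] ≤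
      ∫ ω, (adaptiveRej α l M (p ω) : ℝ)⁻¹ ∂P + ∫ ω, nullFraction α l M I (p ω) ^ 2 ∂P -
        (∫ ω, nullFraction α l M I (p ω) ∂P) ^ 2 := by
  rw [variance_eq_sub (hM.memLp_FDP h), hM.integral_FDP h]
  exact sub_le_sub_right (hM.integral_FDP_sq_le h) _

end NullEstimator

end Moments

section BenjaminiHochberg

variable {m : ℕ} {α : ℝ}

/-- The estimator `m` of the Benjamini-Hochberg test, made positive at the degenerate index
`m = 0`. -/
noncomputable def trivialEst (m : ℕ) (_ : Fin m → ℝ) : ℝ := max (m : ℝ) 1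

theorem trivialEst_eq (hm : 1 ≤ m) (q : Fin m → ℝ) : trivialEst m q = m :=
  max_eq_left (by exact_mod_cast hm)

theorem nullEstimator_trivialEst (hα : 0 < α) (hα1 : α ≤ 1) (m : ℕ) :
    NullEstimator α 1 (trivialEst m) where
  alpha_pos := hα
  cap_pos := one_pos
  cap_le := le_rfl
  measurable := measurable_const
  one_le _ := le_max_right _ _
  le_apply q := by
    have hcount : (countLE Finset.univ q 1 : ℝ) ≤ m := by exact_mod_cast countLE_univ_le q 1
    rw [div_one]
    exact (mul_le_of_le_one_left (Nat.cast_nonneg _) hα1).trans (hcount.trans (le_max_left _ _))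
  apply_update _ _ _ := rfl

theorem critBH_eq (hα : 0 ≤ α) (hα1 : α ≤ 1) (q : Fin m → ℝ) {i : ℕ} (hi : i ≤ m) :
    critBH α m i = critAdaptive α 1 (trivialEst m q) i := by
  rcases Nat.eq_zero_or_pos m with rfl | hm
  · obtain rfl : i = 0 := by omega
    simp [critBH, critAdaptive]
  · have hfrac : (i : ℝ) / m ≤ 1 := div_le_one_of_le₀ (by exact_mod_cast hi) (Nat.cast_nonneg _)
    rw [critAdaptive, trivialEst_eq hm, critBH, min_eq_left (mul_le_one₀ hfrac hα hα1)]

theorem fdpBH_eq (hα : 0 ≤ α) (hα1 : α ≤ 1) (I : Finset (Fin m)) (q : Fin m → ℝ) :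
    fdpBH α I q = FDP (critAdaptive α 1 (trivialEst m q)) q I :=
  FDP_congr q I fun _ hi => critBH_eq hα hα1 q hi

variable {Ω : Type*} [MeasurableSpace Ω] {P : Measure Ω} [IsProbabilityMeasure P]
  {p : Ω → Fin m → ℝ} {I : Finset (Fin m)}

theorem integral_fdpBH (hBI : BasicIndependence P p I) (hα : 0 < α) (hα1 : α ≤ 1) (hm : 1 ≤ m) :
    ∫ ω, fdpBH α I (p ω) ∂P = I.card / m * α := by
  have hfrac : ∀ ω, nullFraction α 1 (trivialEst m) I (p ω) = I.card / m * α := fun ω => by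
    rw [nullFraction, countLE_eq_card_of_le fun i => (hBI.mem_Icc ω i).2, trivialEst_eq hm]
    ring
  simp only [fdpBH_eq hα.le hα1, (nullEstimator_trivialEst hα hα1 m).integral_FDP hBI, hfrac,
    integral_const, probReal_univ, one_smul]

theorem fdpBH_eq_zero_of_lt (hα : 0 < α) (hα1 : α ≤ 1) {q : Fin m → ℝ} {K : ℝ}
    (hR : (adaptiveRej α 1 (trivialEst m) q : ℝ) ≤ K) (hq : ∀ i ∈ I, K / m * α < q i) :
    fdpBH α I q = 0 := by
  rw [fdpBH_eq hα.le hα1, FDP_critAdaptive_eq_sum]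
  refine Finset.sum_eq_zero fun i hi => if_neg (not_le.2 (lt_of_le_of_lt ?_ (hq i hi)))
  rw [(nullEstimator_trivialEst hα hα1 m).thr_eq, trivialEst_eq (Fin.pos i)]
  gcongr

theorem pow_mul_measureReal_rej_le (hBI : BasicIndependence P p I) (hα : 0 < α) (hα1 : α ≤ 1)
    {K : ℕ} (hK : K ≤ m) :
    (1 + -(K * α) / m) ^ m * P.real {ω | adaptiveRej α 1 (trivialEst m) (p ω) ≤ K} ≤
      P.real {ω | fdpBH α I (p ω) = 0} := by
  have hs : (K : ℝ) / m * α ∈ Set.Icc (0 : ℝ) 1 :=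
    ⟨by positivity, mul_le_one₀ (div_le_one_of_le₀ (by exact_mod_cast hK) (Nat.cast_nonneg _))
      hα.le hα1⟩
  have hup : IsUpperSet {q : Fin m → ℝ | adaptiveRej α 1 (trivialEst m) q ≤ K} :=
    fun _ _ hq hR => (numRej_mono (fun _ _ => le_rfl) hq).trans hR
  calc (1 + -(K * α) / m) ^ m * P.real {ω | adaptiveRej α 1 (trivialEst m) (p ω) ≤ K}
      ≤ (1 - K / m * α) ^ I.card * P.real {ω | adaptiveRej α 1 (trivialEst m) (p ω) ≤ K} := by
        rw [neg_div, ← sub_eq_add_neg, mul_div_right_comm]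
        gcongr ?_ * _
        exact pow_le_pow_of_le_one (sub_nonneg.2 hs.2) (sub_le_self _ hs.1)
          (card_finset_fin_le I)
    _ ≤ P.real {ω | adaptiveRej α 1 (trivialEst m) (p ω) ≤ K ∧ ∀ i ∈ I, K / m * α < p ω i} :=
        IsUniformNull.pow_mul_measureReal_le_inter hs
          ((nullEstimator_trivialEst hα hα1 m).measurable_rej measurableSet_Iic) hup
          fun _ => hBI.isUniformNull
    _ ≤ P.real {ω | fdpBH α I (p ω) = 0} := measureReal_mono fun _ hω =>
        fdpBH_eq_zero_of_lt hα hα1 (by exact_mod_cast hω.1) hω.2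

end BenjaminiHochberg

section Asymptotics

variable {Ω : ℕ → Type*} [∀ m, MeasurableSpace (Ω m)] {P : ∀ m, Measure (Ω m)}
  [∀ m, IsProbabilityMeasure (P m)] {p : ∀ m, Ω m → Fin m → ℝ} {I₀ : ∀ m, Finset (Fin m)}
  {α κ₀ : ℝ}

/-- Convergence of `nullFraction` to a constant makes its variance vanish, and the variance of the
false discovery proportion exceeds the latter by at most `E (1 / R)`. -/
theorem consistent_of_tendsto_nullFraction (hBI : ∀ m, BasicIndependence (P m) (p m) (I₀ m))
    {l : ℝ} {M : ∀ m, (Fin m → ℝ) → ℝ} (hM : ∀ m, NullEstimator α l (M m)) {w : ℝ}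
    (hW : Tendsto (fun x : Σ m, Ω m => nullFraction α l (M x.1) (I₀ x.1) (p x.1 x.2)) (whp P)
      (𝓝 w))
    (hR : Tendsto (fun x : Σ m, Ω m => adaptiveRej α l (M x.1) (p x.1 x.2)) (whp P) atTop) :
    Consistent P fun m ω => FDP (critAdaptive α l (M m (p m ω))) (p m ω) (I₀ m) := by
  have hWm : ∀ m, Measurable fun ω => nullFraction α l (M m) (I₀ m) (p m ω) := fun m =>
    ((hM m).measurable_nullFraction (I₀ m)).comp (hBI m).measurable_fun
  have hWIcc : ∀ m ω, nullFraction α l (M m) (I₀ m) (p m ω) ∈ Set.Icc (0 : ℝ) 1 := fun m ω =>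
    (hM m).nullFraction_mem_Icc _ _
  have hmean := tendsto_integral_of_tendsto_whp hWm
    (fun m ω => abs_le_one_of_mem_Icc (hWIcc m ω)) hW
  have hsq := tendsto_integral_of_tendsto_whp (fun m => (hWm m).pow_const 2)
    (fun m ω => abs_le_one_of_mem_Icc ⟨sq_nonneg _, pow_le_one₀ (hWIcc m ω).1 (hWIcc m ω).2⟩)
    (hW.pow 2)
  have hinv := tendsto_integral_of_tendsto_whp (P := P)
    (X := fun m ω => (adaptiveRej α l (M m) (p m ω) : ℝ)⁻¹)
    (fun m => ((hM m).measurable_rej_cast.comp (hBI m).measurable_fun).inv) (B := 1)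
    (fun m ω => abs_le_one_of_mem_Icc ⟨by positivity, Nat.cast_inv_le_one _⟩)
    (tendsto_inv_atTop_zero.comp (tendsto_natCast_atTop_atTop.comp hR))
  have hlim := (hinv.add hsq).sub (hmean.pow 2)
  rw [zero_add, sub_self] at hlim
  exact consistent_of_tendsto_variance (fun m => (hM m).memLp_FDP (hBI m))
    (squeeze_zero (fun m => variance_nonneg _ _) (fun m => (hM m).variance_FDP_le (hBI m)) hlim)

theorem tendsto_integral_fdpBH (hBI : ∀ m, BasicIndependence (P m) (p m) (I₀ m))
    (hα : 0 < α) (hα1 : α ≤ 1)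
    (hκ : Tendsto (fun m : ℕ => ((I₀ m).card : ℝ) / (m : ℝ)) atTop (𝓝 κ₀)) :
    Tendsto (fun m => ∫ ω, fdpBH α (I₀ m) (p m ω) ∂(P m)) atTop (𝓝 (κ₀ * α)) := by
  refine (hκ.mul_const α).congr' ?_
  filter_upwards [eventually_ge_atTop 1] with m hm
  exact (integral_fdpBH (hBI m) hα hα1 hm).symm

/-- If at most `K` hypotheses are rejected, then with conditional probability at least about
`exp (-K α)` no true null lies below `K α / m`, and there is no false rejection. A consistent test
with nonvanishing false discovery rate excludes this. -/
theorem tendsto_rej_of_consistent (hBI : ∀ m, BasicIndependence (P m) (p m) (I₀ m))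
    (hα : 0 < α) (hα1 : α ≤ 1) (hκ₀ : κ₀ ≠ 0)
    (hκ : Tendsto (fun m : ℕ => ((I₀ m).card : ℝ) / (m : ℝ)) atTop (𝓝 κ₀))
    (hc : Consistent P fun m ω => fdpBH α (I₀ m) (p m ω)) :
    Tendsto (fun x : Σ m, Ω m => adaptiveRej α 1 (trivialEst x.1) (p x.1 x.2)) (whp P)
      atTop := by
  refine tendsto_atTop.2 fun K => Eventually.mono (p := fun x =>
    ¬ adaptiveRej α 1 (trivialEst x.1) (p x.1 x.2) ≤ K) ?_ fun _ hx => (not_le.1 hx).le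
  have hne := (tendsto_whp_of_consistent hc (tendsto_integral_fdpBH hBI hα hα1 hκ)).eventually_ne
    (mul_ne_zero hκ₀ hα.ne')
  simp only [eventually_whp_iff_tendsto_measureReal, not_not] at hne ⊢
  have hexp := Real.tendsto_one_add_div_pow_exp (-(K * α))
  have hdiv := hne.div hexp (Real.exp_pos _).ne'
  rw [zero_div] at hdiv
  refine squeeze_zero' (.of_forall fun _ => measureReal_nonneg) ?_ hdiv
  filter_upwards [eventually_ge_atTop K, hexp.eventually_const_lt (Real.exp_pos _)] with m hm hpos
  exact (le_div_iff₀' hpos).2 (pow_mul_measureReal_rej_le (hBI m) hα hα1 hm)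

theorem tendsto_countLE_sub_div (hBI : ∀ m, BasicIndependence (P m) (p m) (I₀ m))
    {t x : ℕ → ℝ} (ht : ∀ m, t m ∈ Set.Icc (0 : ℝ) 1) (hx : ∀ᶠ m in atTop, 0 < x m)
    (htx : Tendsto (fun m : ℕ => (m : ℝ) * t m / x m ^ 2) atTop (𝓝 0)) :
    Tendsto (fun y : Σ m, Ω m =>
      ((countLE (I₀ y.1) (p y.1 y.2) (t y.1) : ℝ) - (I₀ y.1).card * t y.1) / x y.1)
      (whp P) (𝓝 0) := by
  rw [← convInProb_iff_tendsto_whp (X := fun m ω =>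
    ((countLE (I₀ m) (p m ω) (t m) : ℝ) - (I₀ m).card * t m) / x m)]
  intro η hη
  have hlim := ENNReal.tendsto_ofReal (htx.div_const (η ^ 2))
  rw [zero_div, ENNReal.ofReal_zero] at hlim
  refine tendsto_of_tendsto_of_tendsto_of_le_of_le' tendsto_const_nhds hlim
    (.of_forall fun _ => zero_le) ?_
  filter_upwards [hx] with m hxm
  have hcard : ((I₀ m).card : ℝ) ≤ m := by exact_mod_cast card_finset_fin_le (I₀ m)
  have ht0 := (ht m).1
  calc P m {ω | η ≤ |((countLE (I₀ m) (p m ω) (t m) : ℝ) - (I₀ m).card * t m) / x m - 0|}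
      = P m {ω | η * x m ≤ |(countLE (I₀ m) (p m ω) (t m) : ℝ) - (I₀ m).card * t m|} := by
        simp only [sub_zero, abs_div, abs_of_pos hxm, le_div_iff₀ hxm]
    _ ≤ ENNReal.ofReal ((I₀ m).card * t m / (η * x m) ^ 2) :=
        (hBI m).measure_le_abs_countLE_sub_le (ht m) (mul_pos hη hxm)
    _ ≤ ENNReal.ofReal (m * t m / x m ^ 2 / η ^ 2) := by
        rw [div_div, mul_pow, mul_comm (η ^ 2)]
        gcongr

theorem tendsto_countLE_div_mul (hBI : ∀ m, BasicIndependence (P m) (p m) (I₀ m))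
    (hκ : Tendsto (fun m : ℕ => ((I₀ m).card : ℝ) / (m : ℝ)) atTop (𝓝 κ₀))
    {t : ℕ → ℝ} (ht : ∀ m, t m ∈ Set.Ioc (0 : ℝ) 1)
    (hmt : Tendsto (fun m : ℕ => (m : ℝ) * t m) atTop atTop) :
    Tendsto (fun y : Σ m, Ω m => (countLE (I₀ y.1) (p y.1 y.2) (t y.1) : ℝ) / (y.1 * t y.1))
      (whp P) (𝓝 κ₀) := by
  have hvar : Tendsto (fun m : ℕ => (m : ℝ) * t m / (m * t m) ^ 2) atTop (𝓝 0) := by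
    simpa only [sq, div_self_mul_self', Function.comp_def] using tendsto_inv_atTop_zero.comp hmt
  have hlim := (tendsto_countLE_sub_div hBI (fun m => Set.Ioc_subset_Icc_self (ht m))
    (hmt.eventually_gt_atTop 0) hvar).add (hκ.comp tendsto_fst_whp)
  rw [zero_add] at hlim
  refine hlim.congr fun y => ?_
  rw [Function.comp_apply, sub_div, mul_div_mul_right _ _ (ht y.1).1.ne', sub_add_cancel]

theorem tendsto_countLE_div (hBI : ∀ m, BasicIndependence (P m) (p m) (I₀ m))
    (hκ : Tendsto (fun m : ℕ => ((I₀ m).card : ℝ) / (m : ℝ)) atTop (𝓝 κ₀))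
    {t : ℝ} (ht : t ∈ Set.Ioc (0 : ℝ) 1) :
    Tendsto (fun y : Σ m, Ω m => (countLE (I₀ y.1) (p y.1 y.2) t : ℝ) / y.1)
      (whp P) (𝓝 (κ₀ * t)) := by
  refine ((tendsto_countLE_div_mul hBI hκ (fun _ => ht)
    (tendsto_natCast_atTop_atTop.atTop_mul_const ht.1)).mul_const t).congr fun y => ?_
  rw [← div_div, div_mul_cancel₀ _ ht.1.ne']

theorem tendsto_compl_card_div
    (hκ : Tendsto (fun m : ℕ => ((I₀ m).card : ℝ) / (m : ℝ)) atTop (𝓝 κ₀)) :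
    Tendsto (fun m : ℕ => (((I₀ m)ᶜ.card : ℕ) : ℝ) / (m : ℝ)) atTop (𝓝 (1 - κ₀)) := by
  refine (hκ.const_sub 1).congr' ?_
  filter_upwards [eventually_ne_atTop 0] with m hm
  rw [Finset.card_compl, Fintype.card_fin, Nat.cast_sub (card_finset_fin_le _), sub_div,
    div_self (Nat.cast_ne_zero.2 hm)]

end Asymptotics

section EmpiricalCDF

variable {m : ℕ}

theorem empCDF_mem_Icc (s : Finset (Fin m)) (q : Fin m → ℝ) (t : ℝ) :
    empCDF s q t ∈ Set.Icc (0 : ℝ) 1 := by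
  rw [empCDF_eq]
  exact ⟨by positivity,
    div_le_one_of_le₀ (by exact_mod_cast countLE_le_card s q t) (Nat.cast_nonneg _)⟩

theorem empCDF_mono (s : Finset (Fin m)) (q : Fin m → ℝ) : Monotone (empCDF s q) := by
  intro t t' ht
  rw [empCDF_eq, empCDF_eq]
  gcongr
  exact countLE_mono le_rfl ht

theorem mul_empCDF_univ (q : Fin m → ℝ) (t : ℝ) :
    m * empCDF Finset.univ q t = countLE Finset.univ q t := by
  rw [empCDF_eq, Finset.card_fin]
  refine mul_div_cancel_of_imp' fun hm => ?_
  exact_mod_cast Nat.le_zero.1 ((countLE_univ_le q t).trans_eq (Nat.cast_eq_zero.1 hm))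

theorem empCDF_univ_eq (I : Finset (Fin m)) (q : Fin m → ℝ) (t : ℝ) :
    empCDF Finset.univ q t =
      (countLE I q t : ℝ) / m + ((Iᶜ.card : ℕ) : ℝ) / m * empCDF Iᶜ q t := by
  have hcompl : ((Iᶜ.card : ℕ) : ℝ) * empCDF Iᶜ q t = countLE Iᶜ q t := by
    rw [empCDF_eq]
    refine mul_div_cancel_of_imp' fun hI => ?_
    exact_mod_cast Nat.le_zero.1 ((countLE_le_card _ q t).trans_eq (Nat.cast_eq_zero.1 hI))
  rw [div_mul_eq_mul_div, hcompl, ← add_div, empCDF_eq, Finset.card_fin, ← countLE_add_compl I]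
  push_cast
  rfl

theorem empCDF_univ_eq_one (hm : 1 ≤ m) {q : Fin m → ℝ} {t : ℝ} (h : ∀ i, q i ≤ t) :
    empCDF Finset.univ q t = 1 := by
  rw [empCDF_eq, countLE_eq_card_of_le h, Finset.card_fin, div_self (by positivity)]

theorem empCDF_update {q : Fin m → ℝ} {i : Fin m} {t : ℝ} (ht : 0 ≤ t) (hi : q i ≤ t) :
    empCDF Finset.univ (Function.update q i 0) t = empCDF Finset.univ q t := by
  rw [empCDF_eq, empCDF_eq, countLE_update ht hi]

end EmpiricalCDF

section Grid

/-- The partition `0 < lam 0 < lam 1 < … < lam k = 1` of `[lam 0, 1]`, with `lam 0 < 1`. -/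
structure IsGrid (k : ℕ) (lam : ℕ → ℝ) : Prop where
  zero_pos : 0 < lam 0
  zero_lt : lam 0 < 1
  lt_succ : ∀ i < k, lam i < lam (i + 1)
  last : lam k = 1

/-- Coefficients `β 1, …, β k` of a convex combination. -/
structure IsConvexWeight (k : ℕ) (β : ℕ → ℝ) : Prop where
  nonneg : ∀ i ∈ Finset.Icc 1 k, 0 ≤ β i
  sum_eq_one : ∑ i ∈ Finset.Icc 1 k, β i = 1

/-- A bound for the sum of the normalized weights which does not depend on the weights. -/
noncomputable def gridBound (k : ℕ) (lam : ℕ → ℝ) : ℝ :=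
  ∑ i ∈ Finset.range k, 1 / (lam (i + 1) - lam i)

namespace IsGrid

variable {k : ℕ} {lam : ℕ → ℝ} (hg : IsGrid k lam) {i j : ℕ}
include hg

theorem le_of_le (hij : i ≤ j) (hj : j ≤ k) : lam i ≤ lam j := by
  induction j, hij using Nat.le_induction with
  | base => exact le_rfl
  | succ n _ ih => exact (ih (by omega)).trans (hg.lt_succ n hj).le

theorem mem_Ioc (hi : i ≤ k) : lam i ∈ Set.Ioc (0 : ℝ) 1 :=
  ⟨hg.zero_pos.trans_le (hg.le_of_le (Nat.zero_le i) hi), (hg.le_of_le hi le_rfl).trans hg.last.le⟩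

theorem gap_pos (hi : i < k) : 0 < lam (i + 1) - lam i :=
  sub_pos.2 (hg.lt_succ i hi)

theorem gap_le_one (hi : i < k) : lam (i + 1) - lam i ≤ 1 := by
  linarith [(hg.mem_Ioc hi.le).1, (hg.mem_Ioc (i := i + 1) hi).2]

theorem k_pos : 0 < k :=
  Nat.pos_of_ne_zero fun hk => hg.zero_lt.ne (hk ▸ hg.last)

theorem gridBound_nonneg : 0 ≤ gridBound k lam :=
  Finset.sum_nonneg fun _ hi => one_div_nonneg.2 (hg.gap_pos (Finset.mem_range.1 hi)).le

end IsGrid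

theorem sum_Icc_one_eq_sum_range {A : Type*} [AddCommMonoid A] (k : ℕ) (f : ℕ → A) :
    ∑ i ∈ Finset.Icc 1 k, f i = ∑ i ∈ Finset.range k, f (i + 1) := by
  rw [Finset.range_eq_Ico, Finset.sum_Ico_add' f 0 k 1]
  rfl

variable {k : ℕ} {lam β : ℕ → ℝ}

theorem normWeight_zero (lam β : ℕ → ℝ) : normWeight lam β 0 = 0 := if_pos rfl

theorem normWeight_succ (lam β : ℕ → ℝ) (i : ℕ) :
    normWeight lam β (i + 1) = β (i + 1) / (lam (i + 1) - lam i) :=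
  if_neg i.succ_ne_zero

theorem sum_normWeight_mul_gap (hg : IsGrid k lam) (hβ : IsConvexWeight k β) :
    ∑ i ∈ Finset.range k, normWeight lam β (i + 1) * (lam (i + 1) - lam i) = 1 := by
  rw [← hβ.sum_eq_one, sum_Icc_one_eq_sum_range]
  refine Finset.sum_congr rfl fun i hi => ?_
  rw [normWeight_succ, div_mul_cancel₀ _ (hg.gap_pos (Finset.mem_range.1 hi)).ne']

theorem normWeight_nonneg (hg : IsGrid k lam) (hβ : ∀ i ∈ Finset.Icc 1 k, 0 ≤ β i) {i : ℕ}
    (hi : i ≤ k) : 0 ≤ normWeight lam β i := by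
  cases i with
  | zero => exact (normWeight_zero lam β).ge
  | succ n =>
    rw [normWeight_succ]
    exact div_nonneg (hβ _ (Finset.mem_Icc.2 ⟨n.succ_pos, hi⟩)) (hg.gap_pos hi).le

theorem normWeight_le_succ (hg : IsGrid k lam) (hβ : ∀ i ∈ Finset.Icc 1 k, 0 ≤ β i)
    (hmono : MonotoneWeights k lam β) {i : ℕ} (hi : i < k) :
    normWeight lam β i ≤ normWeight lam β (i + 1) := by
  rcases Nat.eq_zero_or_pos i with rfl | h0
  · exact (normWeight_zero lam β).trans_le (normWeight_nonneg hg hβ hi)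
  · exact hmono i h0 hi

theorem sum_normWeight_le (hg : IsGrid k lam) (hβ : IsConvexWeight k β) :
    ∑ i ∈ Finset.range k, normWeight lam β (i + 1) ≤ gridBound k lam := by
  refine Finset.sum_le_sum fun i hi => ?_
  rw [Finset.mem_range] at hi
  rw [normWeight_succ]
  refine div_le_div_of_nonneg_right ?_ (hg.gap_pos hi).le
  exact hβ.sum_eq_one ▸ Finset.single_le_sum hβ.nonneg (Finset.mem_Icc.2 ⟨i.succ_pos, hi⟩)

theorem normWeight_le (hg : IsGrid k lam) (hβ : IsConvexWeight k β) {i : ℕ} (hi : i ≤ k) :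
    normWeight lam β i ≤ gridBound k lam := by
  cases i with
  | zero => exact (normWeight_zero lam β).trans_le hg.gridBound_nonneg
  | succ n =>
    exact (Finset.single_le_sum (f := fun i => normWeight lam β (i + 1))
      (fun i hi => normWeight_nonneg hg hβ.nonneg (Finset.mem_range.1 hi))
      (Finset.mem_range.2 hi)).trans (sum_normWeight_le hg hβ)

end Grid

section Storey

variable {α : ℝ} {k : ℕ} {lam β : ℕ → ℝ} {m : ℕ} {q : Fin m → ℝ}

theorem storeyInterval_succ_div (hm : 1 ≤ m) (i : ℕ) :
    storeyInterval lam q (i + 1) / m =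
      (empCDF Finset.univ q (lam (i + 1)) - empCDF Finset.univ q (lam i) + 1 / m) /
        (lam (i + 1) - lam i) :=
  mul_div_cancel_left₀ _ (by positivity)

theorem one_le_storeyInterval_succ (hg : IsGrid k lam) (hm : 1 ≤ m) {i : ℕ} (hi : i < k) :
    1 ≤ storeyInterval lam q (i + 1) := by
  have hm' : (0 : ℝ) < m := by positivity
  rw [← div_le_div_iff_of_pos_right hm', storeyInterval_succ_div hm]
  have hF := empCDF_mono Finset.univ q (hg.lt_succ i hi).le
  calc 1 / (m : ℝ) ≤ 1 / m / (lam (i + 1) - lam i) :=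
        le_div_self (by positivity) (hg.gap_pos hi) (hg.gap_le_one hi)
    _ ≤ _ := div_le_div_of_nonneg_right (by linarith) (hg.gap_pos hi).le

theorem one_le_storeyHat (hg : IsGrid k lam) (hβ : IsConvexWeight k β) (α : ℝ) (hm : 1 ≤ m) :
    1 ≤ storeyHat α k lam β q := by
  refine le_trans ?_ (le_max_left _ _)
  calc 1 = ∑ i ∈ Finset.Icc 1 k, β i := hβ.sum_eq_one.symm
    _ ≤ storeyComb k lam β q := by
      refine Finset.sum_le_sum fun i hi => le_mul_of_one_le_right (hβ.nonneg i hi) ?_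
      obtain ⟨hi1, hik⟩ := Finset.mem_Icc.1 hi
      rw [← Nat.sub_add_cancel hi1]
      exact one_le_storeyInterval_succ hg hm (by omega)

theorem storeyHat_div (hm : 1 ≤ m) :
    storeyHat α k lam β q / m =
      max (storeyComb k lam β q / m) (α / lam 0 * empCDF Finset.univ q (lam 0)) := by
  have hm' : (0 : ℝ) < m := by positivity
  rw [storeyHat, ← max_div_div_right hm'.le, mul_left_comm, mul_div_cancel_left₀ _ hm'.ne']

theorem storeyComb_div (hm : 1 ≤ m) :
    storeyComb k lam β q / m = ∑ i ∈ Finset.range k, normWeight lam β (i + 1) *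
      (empCDF Finset.univ q (lam (i + 1)) - empCDF Finset.univ q (lam i) + 1 / m) := by
  rw [storeyComb, sum_Icc_one_eq_sum_range, Finset.sum_div]
  refine Finset.sum_congr rfl fun i _ => ?_
  rw [mul_div_assoc, storeyInterval_succ_div hm, normWeight_succ, div_mul_eq_mul_div,
    mul_div_assoc]

/-- Summation by parts, applied to the deviations `F (lam i) - lam i`, which vanish at `i = k`. -/
theorem storeyComb_div_eq (hg : IsGrid k lam) (hβ : IsConvexWeight k β) (hm : 1 ≤ m)
    (hq : ∀ i, q i ≤ 1) :
    storeyComb k lam β q / m = 1 + (∑ i ∈ Finset.range k, normWeight lam β (i + 1)) / m -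
      ∑ i ∈ Finset.range k, (normWeight lam β (i + 1) - normWeight lam β i) *
        (empCDF Finset.univ q (lam i) - lam i) := by
  set g := normWeight lam β
  let D : ℕ → ℝ := fun i => empCDF Finset.univ q (lam i) - lam i
  have htel : ∑ i ∈ Finset.range k, (g (i + 1) * D (i + 1) - g i * D i) = 0 := by
    have hlast : D k = 0 := by
      simp only [D, empCDF_univ_eq_one hm fun i => (hq i).trans hg.last.ge]
      rw [hg.last, sub_self]
    rw [Finset.sum_range_sub fun i => g i * D i, hlast, show g 0 = 0 from normWeight_zero lam β]
    ring
  calc storeyComb k lam β q / m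
      = ∑ i ∈ Finset.range k, (g (i + 1) * (lam (i + 1) - lam i) + g (i + 1) / m -
          (g (i + 1) - g i) * D i + (g (i + 1) * D (i + 1) - g i * D i)) := by
        rw [storeyComb_div hm]
        refine Finset.sum_congr rfl fun i _ => ?_
        simp only [D, g]
        ring
    _ = _ := by
        rw [Finset.sum_add_distrib, htel, Finset.sum_sub_distrib, Finset.sum_add_distrib,
          sum_normWeight_mul_gap hg hβ, Finset.sum_div, add_zero]

theorem mul_le_sum_normWeight_mul (hg : IsGrid k lam) (hβ : IsConvexWeight k β)
    (hmono : MonotoneWeights k lam β) {D ε : ℕ → ℝ} (hε : ∀ i < k, 0 ≤ ε i) {x η : ℝ}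
    (hx : 0 ≤ x) (hη : 0 ≤ η) (hD : ∀ i < k, x * (ε i - η) ≤ D i) {n : ℕ} (hn : n < k) :
    x * ((normWeight lam β (n + 1) - normWeight lam β n) * ε n - η * gridBound k lam) ≤
      ∑ i ∈ Finset.range k, (normWeight lam β (i + 1) - normWeight lam β i) * D i := by
  set g := normWeight lam β
  have hincr : ∀ i ∈ Finset.range k, 0 ≤ g (i + 1) - g i := fun i hi =>
    sub_nonneg.2 (normWeight_le_succ hg hβ.nonneg hmono (Finset.mem_range.1 hi))
  have htotal : ∑ i ∈ Finset.range k, (g (i + 1) - g i) ≤ gridBound k lam := by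
    rw [Finset.sum_range_sub, show g 0 = 0 from normWeight_zero lam β, sub_zero]
    exact normWeight_le hg hβ le_rfl
  have hsingle : (g (n + 1) - g n) * ε n ≤ ∑ i ∈ Finset.range k, (g (i + 1) - g i) * ε i :=
    Finset.single_le_sum (f := fun i => (g (i + 1) - g i) * ε i)
      (fun i hi => mul_nonneg (hincr i hi) (hε i (Finset.mem_range.1 hi))) (Finset.mem_range.2 hn)
  calc x * ((g (n + 1) - g n) * ε n - η * gridBound k lam)
      ≤ x * (∑ i ∈ Finset.range k, (g (i + 1) - g i) * ε i -
          η * ∑ i ∈ Finset.range k, (g (i + 1) - g i)) := by gcongr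
    _ = ∑ i ∈ Finset.range k, (g (i + 1) - g i) * (x * (ε i - η)) := by
        rw [Finset.mul_sum, ← Finset.sum_sub_distrib, Finset.mul_sum]
        exact Finset.sum_congr rfl fun i _ => by ring
    _ ≤ ∑ i ∈ Finset.range k, (g (i + 1) - g i) * D i :=
        Finset.sum_le_sum fun i hi =>
          mul_le_mul_of_nonneg_left (hD i (Finset.mem_range.1 hi)) (hincr i hi)

theorem storeyComb_div_le (hg : IsGrid k lam) (hβ : IsConvexWeight k β)
    (hmono : MonotoneWeights k lam β) (hm : 1 ≤ m) (hq : ∀ i, q i ≤ 1) {ε : ℕ → ℝ}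
    (hε : ∀ i < k, 0 ≤ ε i) {x η : ℝ} (hx : 0 ≤ x) (hη : 0 ≤ η)
    (hF : ∀ i < k, lam i + x * (ε i - η) ≤ empCDF Finset.univ q (lam i)) {n : ℕ} (hn : n < k) :
    storeyComb k lam β q / m ≤ 1 + gridBound k lam / m -
      x * ((normWeight lam β (n + 1) - normWeight lam β n) * ε n - η * gridBound k lam) := by
  rw [storeyComb_div_eq hg hβ hm hq]
  gcongr
  · exact sum_normWeight_le hg hβ
  · exact mul_le_sum_normWeight_mul hg hβ hmono hε hx hη
      (fun i hi => by linarith [hF i hi]) hn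

end Storey

section StoreyEst

/-- The estimator `storeyHat` of the adaptive test, truncated from below at one. Both agree at the
observed `p`-values, but only the truncation is known to be positive at the remaining arguments. -/
noncomputable def storeyEst (α : ℝ) (k : ℕ) (lam : ℕ → ℝ) (b : ∀ i, (Set.Ici (lam i) → ℝ) → ℝ)
    {m : ℕ} (q : Fin m → ℝ) : ℝ :=
  max (storeyHat α k lam (weights b q) q) 1

variable {α : ℝ} {k : ℕ} {lam : ℕ → ℝ} {b : ∀ i, (Set.Ici (lam i) → ℝ) → ℝ} {m : ℕ}

theorem measurable_weights {i : ℕ} (hb : Measurable (b i)) :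
    Measurable fun q : Fin m → ℝ => weights b q i :=
  hb.comp (measurable_pi_lambda _ fun _ => measurable_empCDF _ _)

theorem measurable_normWeight_weights (hb : ∀ i ∈ Finset.Icc 1 k, Measurable (b i)) {i : ℕ}
    (hi : i ≤ k) : Measurable fun q : Fin m → ℝ => normWeight lam (weights b q) i := by
  cases i with
  | zero => simp only [normWeight_zero, measurable_const]
  | succ n =>
    simp only [normWeight_succ]
    exact (measurable_weights (hb _ (Finset.mem_Icc.2 ⟨n.succ_pos, hi⟩))).div_const _

theorem measurable_storeyHat (hb : ∀ i ∈ Finset.Icc 1 k, Measurable (b i)) :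
    Measurable fun q : Fin m → ℝ => storeyHat α k lam (weights b q) q := by
  refine Measurable.max (Finset.measurable_sum _ fun i hi => ?_)
    (((measurable_empCDF _ _).const_mul _).const_mul _)
  refine (measurable_weights (hb i hi)).mul (Measurable.const_mul ?_ _)
  exact (((measurable_empCDF _ _).sub (measurable_empCDF _ _)).add_const _).div_const _

theorem weights_congr {q q' : Fin m → ℝ} {i : ℕ}
    (h : ∀ t, lam i ≤ t → empCDF Finset.univ q t = empCDF Finset.univ q' t) :
    weights b q i = weights b q' i :=
  congrArg (b i) (funext fun t => h t t.2)

theorem storeyHat_congr (hg : IsGrid k lam) {q q' : Fin m → ℝ}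
    (h : ∀ t, lam 0 ≤ t → empCDF Finset.univ q t = empCDF Finset.univ q' t) :
    storeyHat α k lam (weights b q) q = storeyHat α k lam (weights b q') q' := by
  have hinterval : ∀ i ∈ Finset.Icc 1 k, weights b q i * storeyInterval lam q i =
      weights b q' i * storeyInterval lam q' i := fun i hi => by
    obtain ⟨-, hik⟩ := Finset.mem_Icc.1 hi
    have hi0 := hg.le_of_le (Nat.zero_le i) hik
    rw [weights_congr fun t ht => h t (hi0.trans ht), storeyInterval, storeyInterval, h _ hi0,
      h _ (hg.le_of_le (Nat.zero_le (i - 1)) (by omega))]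
  rw [storeyHat, storeyHat, storeyComb, storeyComb, Finset.sum_congr rfl hinterval, h _ le_rfl]

theorem nullEstimator_storeyEst (hg : IsGrid k lam) (hα : 0 < α)
    (hb : ∀ i ∈ Finset.Icc 1 k, Measurable (b i)) :
    NullEstimator α (lam 0) (storeyEst α k lam b (m := m)) where
  alpha_pos := hα
  cap_pos := hg.zero_pos
  cap_le := hg.zero_lt.le
  measurable := (measurable_storeyHat hb).max measurable_const
  one_le _ := le_max_right _ _
  le_apply q := by
    rw [← mul_empCDF_univ]
    exact (le_max_right _ _).trans (le_max_left _ _)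
  apply_update q i hi := by
    rw [storeyEst, storeyEst, storeyHat_congr hg fun t ht =>
      empCDF_update (hg.zero_pos.le.trans ht) (hi.trans ht)]

theorem storeyEst_eq (hg : IsGrid k lam) {q : Fin m → ℝ} (hβ : IsConvexWeight k (weights b q))
    (hm : 1 ≤ m) : storeyEst α k lam b q = storeyHat α k lam (weights b q) q :=
  max_eq_left (one_le_storeyHat hg hβ α hm)

theorem fdpStorey_eq (hg : IsGrid k lam) (I : Finset (Fin m)) {q : Fin m → ℝ}
    (hβ : IsConvexWeight k (weights b q)) :
    fdpStorey α k lam b I q = FDP (critAdaptive α (lam 0) (storeyEst α k lam b q)) q I := by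
  refine FDP_congr q I fun i hi => ?_
  rcases Nat.eq_zero_or_pos m with rfl | hm
  · obtain rfl : i = 0 := by omega
    simp [critAdaptive]
  · rw [storeyEst_eq hg hβ hm]

theorem countLE_le_adaptiveRej {l t : ℝ} {M : (Fin m → ℝ) → ℝ} {q : Fin m → ℝ}
    (hM : 0 < M q) (htl : t ≤ l) (h : t * M q ≤ countLE Finset.univ q t * α) :
    countLE Finset.univ q t ≤ adaptiveRej α l M q := by
  refine le_numRej (countLE_mono le_rfl (le_min ?_ htl))
  rwa [div_mul_eq_mul_div, le_div_iff₀ hM]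

theorem adaptiveRej_trivialEst_le {l : ℝ} (hα : 0 ≤ α) (hαl : α ≤ l) {M : (Fin m → ℝ) → ℝ}
    {q : Fin m → ℝ} (hM : 0 < M q) (h : M q ≤ m) :
    adaptiveRej α 1 (trivialEst m) q ≤ adaptiveRej α l M q := by
  refine numRej_mono (fun i hi => (min_le_left _ _).trans ?_) le_rfl
  have hm : (0 : ℝ) < m := hM.trans_le h
  have hfrac : (i : ℝ) / m ≤ 1 := div_le_one_of_le₀ (by exact_mod_cast hi) hm.le
  rw [trivialEst_eq (by exact_mod_cast hm)]
  exact le_min (by gcongr) ((mul_le_of_le_one_left hα hfrac).trans hαl)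

end StoreyEst

theorem tendsto_atTop_of_tendsto_div_sqrt {x : ℕ → ℝ} (hx : ∀ m, 0 ≤ x m)
    (hs : Tendsto (fun m : ℕ => x m / Real.sqrt m) atTop atTop) : Tendsto x atTop atTop := by
  refine tendsto_atTop_mono' _ ?_ hs
  filter_upwards [eventually_ge_atTop 1] with m hm
  exact div_le_self (hx m) (Real.one_le_sqrt.2 (by exact_mod_cast hm))

theorem tendsto_div_sqrt_atTop_of_tendsto_div {x : ℕ → ℝ} {c : ℝ} (hc : 0 < c)
    (hx : Tendsto (fun m : ℕ => x m / m) atTop (𝓝 c)) :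
    Tendsto (fun m : ℕ => x m / Real.sqrt m) atTop atTop := by
  refine (hx.pos_mul_atTop hc (Real.tendsto_sqrt_atTop.comp tendsto_natCast_atTop_atTop)).congr
    fun m => ?_
  rw [Function.comp_apply, div_mul_eq_mul_div, mul_div_assoc, Real.sqrt_div_self, ← div_eq_mul_inv]

section EmpiricalCDF

variable {Ω : ℕ → Type*} [∀ m, MeasurableSpace (Ω m)] {P : ∀ m, Measure (Ω m)}
  [∀ m, IsProbabilityMeasure (P m)] {p : ∀ m, Ω m → Fin m → ℝ} {I₀ : ∀ m, Finset (Fin m)} {κ₀ : ℝ}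

theorem tendsto_empCDF_univ (hBI : ∀ m, BasicIndependence (P m) (p m) (I₀ m))
    (hκ : Tendsto (fun m : ℕ => ((I₀ m).card : ℝ) / (m : ℝ)) atTop (𝓝 κ₀)) {t a : ℝ}
    (ht : t ∈ Set.Ioc 0 1)
    (ha : Tendsto (fun x : Σ m, Ω m => (((I₀ x.1)ᶜ.card : ℕ) : ℝ) / (x.1 : ℝ) *
      empCDF (I₀ x.1)ᶜ (p x.1 x.2) t) (whp P) (𝓝 a)) :
    Tendsto (fun x : Σ m, Ω m => empCDF Finset.univ (p x.1 x.2) t) (whp P) (𝓝 (κ₀ * t + a)) :=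
  ((tendsto_countLE_div hBI hκ ht).add ha).congr fun x => (empCDF_univ_eq (I₀ x.1) _ _).symm

theorem tendsto_empCDF_univ_of_tendsto_card (hBI : ∀ m, BasicIndependence (P m) (p m) (I₀ m))
    (hκ : Tendsto (fun m : ℕ => ((I₀ m).card : ℝ) / (m : ℝ)) atTop (𝓝 1)) {t : ℝ}
    (ht : t ∈ Set.Ioc 0 1) :
    Tendsto (fun x : Σ m, Ω m => empCDF Finset.univ (p x.1 x.2) t) (whp P) (𝓝 t) := by
  have hm₁ := (tendsto_compl_card_div hκ).comp (tendsto_fst_whp (P := P))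
  rw [sub_self] at hm₁
  have hlim := tendsto_empCDF_univ hBI hκ ht <| squeeze_zero
    (fun _ => mul_nonneg (by positivity) (empCDF_mem_Icc _ _ _).1)
    (fun _ => mul_le_of_le_one_right (by positivity) (empCDF_mem_Icc _ _ _).2) hm₁
  rwa [one_mul, add_zero] at hlim

theorem eventually_mul_le_countLE (hBI : ∀ m, BasicIndependence (P m) (p m) (I₀ m))
    (hκ : Tendsto (fun m : ℕ => ((I₀ m).card : ℝ) / (m : ℝ)) atTop (𝓝 κ₀))
    {t : ℕ → ℝ} (ht : ∀ m, t m ∈ Set.Ioc (0 : ℝ) 1)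
    (hmt : Tendsto (fun m : ℕ => (m : ℝ) * t m) atTop atTop) {a c : ℝ} (hc : c < κ₀ + a)
    (ha : ∀ᶠ x : Σ m, Ω m in whp P, a ≤ (((I₀ x.1)ᶜ.card : ℕ) : ℝ) / (x.1 : ℝ) *
      (empCDF (I₀ x.1)ᶜ (p x.1 x.2) (t x.1) / t x.1)) :
    ∀ᶠ x : Σ m, Ω m in whp P,
      c * (x.1 * t x.1) ≤ countLE Finset.univ (p x.1 x.2) (t x.1) := by
  filter_upwards [ha, (tendsto_countLE_div_mul hBI hκ ht hmt).eventually_const_lt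
    (sub_lt_iff_lt_add.2 hc), eventually_one_le_fst_whp] with x hx hN hm
  have hm' : (0 : ℝ) < x.1 := by positivity
  have ht' := (ht x.1).1
  rw [← mul_empCDF_univ, mul_left_comm, mul_le_mul_iff_right₀ hm', ← le_div_iff₀ ht',
    empCDF_univ_eq (I₀ x.1), add_div, div_div, mul_div_assoc]
  linarith

/-- By Chebyshev's inequality the true nulls contribute an error of order `√m`, which is negligible
against the number `m₁` of false nulls. -/
theorem eventually_le_empCDF_univ (hBI : ∀ m, BasicIndependence (P m) (p m) (I₀ m))
    (hs : Tendsto (fun m : ℕ => (((I₀ m)ᶜ.card : ℕ) : ℝ) / Real.sqrt (m : ℝ)) atTop atTop)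
    {t a η : ℝ} (ht : t ∈ Set.Icc 0 1) (hη : 0 < η)
    (hF : Tendsto (fun x : Σ m, Ω m => empCDF (I₀ x.1)ᶜ (p x.1 x.2) t) (whp P) (𝓝 (t + a))) :
    ∀ᶠ x : Σ m, Ω m in whp P, t + (((I₀ x.1)ᶜ.card : ℕ) : ℝ) / (x.1 : ℝ) * (a - η) ≤
      empCDF Finset.univ (p x.1 x.2) t := by
  have hcard := tendsto_atTop_of_tendsto_div_sqrt (fun m => Nat.cast_nonneg _) hs
  have hvar : Tendsto (fun m : ℕ => (m : ℝ) * t / (((I₀ m)ᶜ.card : ℕ) : ℝ) ^ 2) atTop (𝓝 0) := by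
    have hlim := ((tendsto_inv_atTop_zero.comp hs).pow 2).mul_const t
    rw [zero_pow two_ne_zero, zero_mul] at hlim
    refine hlim.congr fun m => ?_
    rw [Function.comp_apply, inv_div, div_pow, Real.sq_sqrt (Nat.cast_nonneg m), div_mul_eq_mul_div]
  have hnull := tendsto_countLE_sub_div hBI (fun _ => ht) (hcard.eventually_gt_atTop 0) hvar
  have hlim := hnull.add (hF.sub_const t)
  filter_upwards [hlim.eventually_const_lt (show a - η < 0 + (t + a - t) by linarith),
    eventually_one_le_fst_whp, tendsto_fst_whp.eventually (hcard.eventually_gt_atTop 0)]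
    with x hx hm hm₁
  have hm' : (0 : ℝ) < x.1 := by positivity
  have hm₀ : ((I₀ x.1).card : ℝ) = x.1 - ((I₀ x.1)ᶜ.card : ℕ) := by
    rw [eq_sub_iff_add_eq]
    exact_mod_cast (Finset.card_add_card_compl _).trans (Fintype.card_fin _)
  calc t + ((I₀ x.1)ᶜ.card : ℕ) / x.1 * (a - η)
      ≤ t + ((I₀ x.1)ᶜ.card : ℕ) / x.1 * ((countLE (I₀ x.1) (p x.1 x.2) t -
          (I₀ x.1).card * t) / ((I₀ x.1)ᶜ.card : ℕ) + (empCDF (I₀ x.1)ᶜ (p x.1 x.2) t - t)) := by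
        gcongr
    _ = empCDF Finset.univ (p x.1 x.2) t := by
      rw [empCDF_univ_eq (I₀ x.1), hm₀]
      field_simp
      ring

end EmpiricalCDF

theorem tendsto_normWeight {X : Type*} {l : Filter X} {k : ℕ} {lam β : ℕ → ℝ} {w : X → ℕ → ℝ}
    (hβ : ∀ i ∈ Finset.Icc 1 k, Tendsto (fun x => w x i) l (𝓝 (β i))) {i : ℕ} (hi : i ≤ k) :
    Tendsto (fun x => normWeight lam (w x) i) l (𝓝 (normWeight lam β i)) := by
  cases i with
  | zero => simpa only [normWeight_zero] using tendsto_const_nhds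
  | succ n =>
    simpa only [normWeight_succ] using
      (hβ (n + 1) (Finset.mem_Icc.2 ⟨n.succ_pos, hi⟩)).div_const _

/-- The standing assumptions on the adaptive test: basic independence, convex weights on a grid
whose smallest point `lam 0` is the cap on the critical values, and convergence of the proportion
of true nulls to `κ₀`, where `κ₀` is so large that `(α / lam 0) R_m(lam 0) / m` stays below one. -/
structure AdaptiveSetting {Ω : ℕ → Type*} [∀ m, MeasurableSpace (Ω m)]
    (P : ∀ m, Measure (Ω m)) (p : ∀ m, Ω m → Fin m → ℝ) (I₀ : ∀ m, Finset (Fin m))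
    (α : ℝ) (k : ℕ) (lam : ℕ → ℝ) (b : ∀ _ : ℕ, ∀ i, (Set.Ici (lam i) → ℝ) → ℝ)
    (κ₀ : ℝ) : Prop where
  basic : ∀ m, BasicIndependence (P m) (p m) (I₀ m)
  alpha_pos : 0 < α
  alpha_le : α ≤ lam 0
  grid : IsGrid k lam
  weights_meas : ∀ m, ∀ i ∈ Finset.Icc 1 k, Measurable (b m i)
  weights_convex : ∀ m, ∀ ω : Ω m, IsConvexWeight k (weights (b m) (p m ω))
  kappa_pos : 0 < κ₀
  kappa_le : κ₀ ≤ 1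
  tendsto_card : Tendsto (fun m : ℕ => ((I₀ m).card : ℝ) / (m : ℝ)) atTop (𝓝 κ₀)
  kappa_lt : α * (1 - κ₀) / (lam 0 * (1 - α)) < κ₀

/-- The estimate of the number of true nulls, divided by the number `m` of hypotheses. -/
noncomputable abbrev relEst {Ω : ℕ → Type*} (p : ∀ m, Ω m → Fin m → ℝ) (α : ℝ) (k : ℕ)
    (lam : ℕ → ℝ) (b : ∀ _ : ℕ, ∀ i, (Set.Ici (lam i) → ℝ) → ℝ) (x : Σ m, Ω m) : ℝ :=
  storeyHat α k lam (weights (b x.1) (p x.1 x.2)) (p x.1 x.2) / (x.1 : ℝ)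

namespace AdaptiveSetting

variable {Ω : ℕ → Type*} [∀ m, MeasurableSpace (Ω m)] {P : ∀ m, Measure (Ω m)}
  {p : ∀ m, Ω m → Fin m → ℝ} {I₀ : ∀ m, Finset (Fin m)}
  {α : ℝ} {k : ℕ} {lam : ℕ → ℝ} {b : ∀ _ : ℕ, ∀ i, (Set.Ici (lam i) → ℝ) → ℝ} {κ₀ : ℝ}
  (h : AdaptiveSetting P p I₀ α k lam b κ₀) {C : ℝ} {ε β : ℕ → ℝ}
include h

theorem alpha_lt_one : α < 1 := h.alpha_le.trans_lt h.grid.zero_lt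

theorem nullEstimator (m : ℕ) : NullEstimator α (lam 0) (storeyEst α k lam (b m) (m := m)) :=
  nullEstimator_storeyEst h.grid h.alpha_pos (h.weights_meas m)

theorem fdp_eq (m : ℕ) (ω : Ω m) : fdpStorey α k lam (b m) (I₀ m) (p m ω) =
    FDP (critAdaptive α (lam 0) (storeyEst α k lam (b m) (p m ω))) (p m ω) (I₀ m) :=
  fdpStorey_eq h.grid _ (h.weights_convex m ω)

theorem storeyEst_eq_relEst_mul {x : Σ m, Ω m} (hx : 1 ≤ x.1) :
    storeyEst α k lam (b x.1) (p x.1 x.2) = relEst p α k lam b x * x.1 := by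
  rw [storeyEst_eq h.grid (h.weights_convex x.1 x.2) hx, relEst, div_mul_cancel₀ _ (by positivity)]

theorem relEst_pos {x : Σ m, Ω m} (hx : 1 ≤ x.1) : 0 < relEst p α k lam b x :=
  div_pos (one_pos.trans_le (one_le_storeyHat h.grid (h.weights_convex x.1 x.2) α hx))
    (by positivity)

theorem nullFraction_eq {x : Σ m, Ω m} (hx : 1 ≤ x.1) :
    nullFraction α (lam 0) (storeyEst α k lam (b x.1)) (I₀ x.1) (p x.1 x.2) =
      α / lam 0 * ((countLE (I₀ x.1) (p x.1 x.2) (lam 0) : ℝ) / x.1 / relEst p α k lam b x) := by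
  rw [nullFraction, h.storeyEst_eq_relEst_mul hx, div_div, mul_comm (x.1 : ℝ)]

theorem measurable_nullFraction (m : ℕ) : Measurable fun ω =>
    nullFraction α (lam 0) (storeyEst α k lam (b m)) (I₀ m) (p m ω) :=
  ((h.nullEstimator m).measurable_nullFraction _).comp (h.basic m).measurable_fun

theorem abs_nullFraction_le_one (m : ℕ) (ω : Ω m) :
    |nullFraction α (lam 0) (storeyEst α k lam (b m)) (I₀ m) (p m ω)| ≤ 1 :=
  abs_le_one_of_mem_Icc ((h.nullEstimator m).nullFraction_mem_Icc _ _)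

theorem cap_lt_one : α / lam 0 * (κ₀ * lam 0 + (1 - κ₀)) < 1 := by
  have hl := h.grid.zero_pos
  have hα : 0 < 1 - α := sub_pos.2 h.alpha_lt_one
  have hκ := (div_lt_iff₀ (by positivity)).1 h.kappa_lt
  rw [div_mul_eq_mul_div, div_lt_one hl]
  linarith [mul_le_mul_of_nonneg_right h.kappa_le hl.le]

theorem measurable_weights_comp (m : ℕ) {i : ℕ} (hi : i ∈ Finset.Icc 1 k) :
    Measurable fun ω => weights (b m) (p m ω) i :=
  (measurable_weights (h.weights_meas m i hi)).comp (h.basic m).measurable_fun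

theorem measurable_empCDF_comp (m : ℕ) (s : Finset (Fin m)) (t : ℝ) :
    Measurable fun ω => empCDF s (p m ω) t :=
  (measurable_empCDF s t).comp (h.basic m).measurable_fun

variable [∀ m, IsProbabilityMeasure (P m)]

theorem integral_fdp (m : ℕ) : ∫ ω, fdpStorey α k lam (b m) (I₀ m) (p m ω) ∂(P m) =
    ∫ ω, nullFraction α (lam 0) (storeyEst α k lam (b m)) (I₀ m) (p m ω) ∂(P m) := by
  simp only [h.fdp_eq]
  exact (h.nullEstimator m).integral_FDP (h.basic m)

theorem tendsto_nullFraction (hC : C ≠ 0)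
    (hhat : Tendsto (relEst p α k lam b) (whp P) (𝓝 C)) :
    Tendsto (fun x : Σ m, Ω m =>
      nullFraction α (lam 0) (storeyEst α k lam (b x.1)) (I₀ x.1) (p x.1 x.2)) (whp P)
      (𝓝 (κ₀ * α / C)) := by
  have hl := h.grid.zero_pos.ne'
  have hlim := ((tendsto_countLE_div h.basic h.tendsto_card
    (h.grid.mem_Ioc (Nat.zero_le k))).div hhat hC).const_mul (α / lam 0)
  rw [show α / lam 0 * (κ₀ * lam 0 / C) = κ₀ * α / C by field_simp] at hlim
  refine hlim.congr' ?_
  filter_upwards [eventually_one_le_fst_whp] with x hx using (h.nullFraction_eq hx).symm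

theorem eventually_le_nullFraction {c r : ℝ} (hc : 0 < c) (hr : r < 1)
    (hhat : ∀ᶠ x in whp P, relEst p α k lam b x ≤ c) :
    ∀ᶠ x : Σ m, Ω m in whp P, κ₀ * α * (r / c) ≤
      nullFraction α (lam 0) (storeyEst α k lam (b x.1)) (I₀ x.1) (p x.1 x.2) := by
  have hl := h.grid.zero_pos
  have hα := h.alpha_pos
  have hnull := (tendsto_countLE_div h.basic h.tendsto_card
    (h.grid.mem_Ioc (Nat.zero_le k))).eventually_const_lt
    (mul_lt_of_lt_one_right (mul_pos h.kappa_pos hl) hr)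
  filter_upwards [hhat, hnull, eventually_one_le_fst_whp] with x hxc hxr hx
  have hpos := h.relEst_pos hx
  rw [h.nullFraction_eq hx]
  calc κ₀ * α * (r / c) = α / lam 0 * (κ₀ * lam 0 * r / c) := by field_simp
    _ ≤ _ := by gcongr

theorem exists_eventually_cap_le : ∃ c < 1, ∀ᶠ x : Σ m, Ω m in whp P,
    α / lam 0 * empCDF Finset.univ (p x.1 x.2) (lam 0) ≤ c := by
  obtain ⟨c, hlt, hc⟩ := exists_between h.cap_lt_one
  have hα := h.alpha_pos
  have hl := h.grid.zero_pos
  have hlim := ((tendsto_countLE_div h.basic h.tendsto_card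
    (h.grid.mem_Ioc (Nat.zero_le k))).add
    ((tendsto_compl_card_div h.tendsto_card).comp tendsto_fst_whp)).const_mul (α / lam 0)
  refine ⟨c, hc, (hlim.eventually_lt_const hlt).mono fun x hx => le_trans ?_ hx.le⟩
  rw [empCDF_univ_eq (I₀ x.1), Function.comp_apply]
  gcongr
  exact mul_le_of_le_one_right (by positivity) (empCDF_mem_Icc _ _ _).2

theorem tendsto_integral_fdp_of_tendsto (hC : C ≠ 0)
    (hhat : Tendsto (relEst p α k lam b) (whp P) (𝓝 C)) :
    Tendsto (fun m => ∫ ω, fdpStorey α k lam (b m) (I₀ m) (p m ω) ∂(P m)) atTop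
      (𝓝 (κ₀ * α / C)) := by
  simp only [h.integral_fdp]
  exact tendsto_integral_of_tendsto_whp h.measurable_nullFraction h.abs_nullFraction_le_one
    (h.tendsto_nullFraction hC hhat)

theorem lt_liminf_integral_fdp {c : ℝ} (hc : c < 1)
    (hhat : ∀ᶠ x in whp P, relEst p α k lam b x ≤ c) :
    κ₀ * α < liminf (fun m => ∫ ω, fdpStorey α k lam (b m) (I₀ m) (p m ω) ∂(P m)) atTop := by
  obtain ⟨c', hc', hc'1⟩ := exists_between (max_lt hc one_pos)
  obtain ⟨hcc', hc'0⟩ := max_lt_iff.1 hc'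
  obtain ⟨r, hrc, hr⟩ := exists_between hc'1
  have hκα := mul_pos h.kappa_pos h.alpha_pos
  simp only [h.integral_fdp]
  calc κ₀ * α < κ₀ * α * (r / c') := lt_mul_of_one_lt_right hκα ((one_lt_div hc'0).2 hrc)
    _ ≤ _ := le_liminf_integral_of_eventually_whp_le h.measurable_nullFraction
      h.abs_nullFraction_le_one
      (h.eventually_le_nullFraction hc'0 hr (hhat.mono fun _ hx => hx.trans hcc'.le))

theorem tendsto_relEst_of_tendsto_card
    (hκ : Tendsto (fun m : ℕ => ((I₀ m).card : ℝ) / (m : ℝ)) atTop (𝓝 1)) :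
    Tendsto (relEst p α k lam b) (whp P) (𝓝 1) := by
  have hF : ∀ i ≤ k, Tendsto (fun x : Σ m, Ω m => empCDF Finset.univ (p x.1 x.2) (lam i)) (whp P)
      (𝓝 (lam i)) := fun i hi =>
    tendsto_empCDF_univ_of_tendsto_card h.basic hκ (h.grid.mem_Ioc hi)
  have hcomb : Tendsto (fun x : Σ m, Ω m => ∑ i ∈ Finset.range k,
      normWeight lam (weights (b x.1) (p x.1 x.2)) (i + 1) *
        (empCDF Finset.univ (p x.1 x.2) (lam (i + 1)) - empCDF Finset.univ (p x.1 x.2) (lam i) +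
          1 / (x.1 : ℝ) - (lam (i + 1) - lam i))) (whp P) (𝓝 0) := by
    rw [← Finset.sum_const_zero (s := Finset.range k)]
    refine tendsto_finsetSum _ fun i hi => ?_
    have hi' := Finset.mem_range.1 hi
    have hdev := (((hF (i + 1) hi').sub (hF i hi'.le)).add (tendsto_const_div_fst_whp 1)).sub_const
      (lam (i + 1) - lam i)
    rw [add_zero, sub_self] at hdev
    refine bdd_le_mul_tendsto_zero' (gridBound k lam) (.of_forall fun x => ?_) hdev
    rw [abs_of_nonneg (normWeight_nonneg h.grid (h.weights_convex x.1 x.2).nonneg hi')]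
    exact normWeight_le h.grid (h.weights_convex x.1 x.2) hi'
  have hlim := (hcomb.const_add 1).max ((hF 0 (Nat.zero_le k)).const_mul (α / lam 0))
  rw [add_zero, div_mul_cancel₀ _ h.grid.zero_pos.ne', max_eq_left h.alpha_lt_one.le] at hlim
  refine hlim.congr' ?_
  filter_upwards [eventually_one_le_fst_whp] with x hx
  rw [relEst, storeyHat_div hx, storeyComb_div hx]
  simp only [mul_sub _ _ (_ - _), Finset.sum_sub_distrib,
    sum_normWeight_mul_gap h.grid (h.weights_convex x.1 x.2), add_sub_cancel]

omit [∀ m, IsProbabilityMeasure (P m)] in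
theorem eventually_storeyComb_div_le
    (hmono : ∀ m, ∀ᵐ ω ∂(P m), MonotoneWeights k lam (weights (b m) (p m ω)))
    (hε : ∀ i < k, 0 ≤ ε i) {x : ℕ → ℝ} (hx : ∀ m, 0 ≤ x m)
    (hmx : Tendsto (fun m : ℕ => (m : ℝ) * x m) atTop atTop)
    (hF : ∀ i < k, ∀ η > 0, ∀ᶠ y : Σ m, Ω m in whp P,
      lam i + x y.1 * (ε i - η) ≤ empCDF Finset.univ (p y.1 y.2) (lam i))
    {n : ℕ} (hn : n < k) {δ : ℝ} (hδ : 0 < δ) (hεn : 0 < ε n)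
    (hd : ∀ᶠ y : Σ m, Ω m in whp P, δ ≤ normWeight lam (weights (b y.1) (p y.1 y.2)) (n + 1) -
      normWeight lam (weights (b y.1) (p y.1 y.2)) n) :
    ∀ᶠ y : Σ m, Ω m in whp P, storeyComb k lam (weights (b y.1) (p y.1 y.2)) (p y.1 y.2) /
      (y.1 : ℝ) ≤ 1 - x y.1 * (δ * ε n / 2) := by
  set G := gridBound k lam
  have hG : 0 ≤ G := h.grid.gridBound_nonneg
  set η : ℝ := δ * ε n / (4 * (G + 1)) with hη_def
  have hη : 0 < η := by positivity
  have hηG : η * G ≤ δ * ε n / 4 := by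
    calc η * G ≤ η * (G + 1) := by gcongr; linarith
      _ = δ * ε n / 4 := by rw [hη_def]; field_simp
  have hFall : ∀ᶠ y : Σ m, Ω m in whp P, ∀ i ∈ Finset.range k,
      lam i + x y.1 * (ε i - η) ≤ empCDF Finset.univ (p y.1 y.2) (lam i) :=
    (Finset.eventually_all _).2 fun i hi => hF i (Finset.mem_range.1 hi) η hη
  have hmxG : ∀ᶠ m : ℕ in atTop, G ≤ m * x m * (δ * ε n / 4) :=
    (hmx.atTop_mul_const (by positivity)).eventually_ge_atTop G
  filter_upwards [hFall, hd, eventually_whp_of_forall_ae hmono, eventually_one_le_fst_whp,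
    tendsto_fst_whp.eventually hmxG] with y hFy hdy hmonoy hm hGy
  have hGm : G / y.1 ≤ x y.1 * (δ * ε n / 4) := by
    rw [div_le_iff₀ (by positivity)]
    linarith
  calc _ ≤ 1 + G / y.1 - x y.1 * ((normWeight lam (weights (b y.1) (p y.1 y.2)) (n + 1) -
          normWeight lam (weights (b y.1) (p y.1 y.2)) n) * ε n - η * G) :=
        storeyComb_div_le h.grid (h.weights_convex y.1 y.2) hmonoy hm
          (fun i => ((h.basic y.1).mem_Icc y.2 i).2) hε (hx y.1) hη.le
          (fun i hi => hFy i (Finset.mem_range.2 hi)) hn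
    _ ≤ 1 + x y.1 * (δ * ε n / 4) - x y.1 * (δ * ε n - δ * ε n / 4) := by
        have := hx y.1
        gcongr
    _ = 1 - x y.1 * (δ * ε n / 2) := by ring

theorem exists_eventually_relEst_le
    (hmono : ∀ m, ∀ᵐ ω ∂(P m), MonotoneWeights k lam (weights (b m) (p m ω)))
    (hε : ∀ i < k, 0 ≤ ε i)
    (hF : ∀ i < k, ∀ c < lam i + ε i, ∀ᶠ x : Σ m, Ω m in whp P,
      c < empCDF Finset.univ (p x.1 x.2) (lam i))
    {n : ℕ} (hn : n < k) {δ : ℝ} (hδ : 0 < δ) (hεn : 0 < ε n)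
    (hd : ∀ᶠ x : Σ m, Ω m in whp P, δ ≤ normWeight lam (weights (b x.1) (p x.1 x.2)) (n + 1) -
      normWeight lam (weights (b x.1) (p x.1 x.2)) n) :
    ∃ c < 1, ∀ᶠ x in whp P, relEst p α k lam b x ≤ c := by
  obtain ⟨c, hc, hcap⟩ := h.exists_eventually_cap_le
  have hcomb := h.eventually_storeyComb_div_le hmono hε (x := fun _ => 1) (fun _ => zero_le_one)
    (by simpa only [mul_one] using tendsto_natCast_atTop_atTop)
    (fun i hi η hη => (hF i hi _ (by linarith)).mono fun _ hx => hx.le) hn hδ hεn hd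
  refine ⟨max (1 - 1 * (δ * ε n / 2)) c, max_lt (by linarith [mul_pos hδ hεn]) hc, ?_⟩
  filter_upwards [hcap, hcomb, eventually_one_le_fst_whp] with x hxcap hxcomb hm
  rw [relEst, storeyHat_div hm]
  exact max_le_max hxcomb hxcap

theorem eventually_relEst_le_one
    (hmono : ∀ m, ∀ᵐ ω ∂(P m), MonotoneWeights k lam (weights (b m) (p m ω)))
    (hε : ∀ i < k, 0 ≤ ε i)
    (hF : ∀ i < k, Tendsto (fun x : Σ m, Ω m => empCDF (I₀ x.1)ᶜ (p x.1 x.2) (lam i)) (whp P)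
      (𝓝 (lam i + ε i)))
    {n : ℕ} (hn : n < k) {δ : ℝ} (hδ : 0 < δ) (hεn : 0 < ε n)
    (hd : ∀ᶠ x : Σ m, Ω m in whp P, δ ≤ normWeight lam (weights (b x.1) (p x.1 x.2)) (n + 1) -
      normWeight lam (weights (b x.1) (p x.1 x.2)) n)
    (hs : Tendsto (fun m : ℕ => (((I₀ m)ᶜ.card : ℕ) : ℝ) / Real.sqrt (m : ℝ)) atTop atTop) :
    ∀ᶠ x in whp P, relEst p α k lam b x ≤ 1 := by
  obtain ⟨c, hc, hcap⟩ := h.exists_eventually_cap_le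
  have hcard := tendsto_atTop_of_tendsto_div_sqrt (fun m => Nat.cast_nonneg _) hs
  have hcomb := h.eventually_storeyComb_div_le hmono hε
    (x := fun m => (((I₀ m)ᶜ.card : ℕ) : ℝ) / m) (fun _ => by positivity)
    (hcard.congr' ((eventually_ne_atTop 0).mono fun m hm =>
      (mul_div_cancel₀ _ (Nat.cast_ne_zero.2 hm)).symm))
    (fun i hi η hη => eventually_le_empCDF_univ h.basic hs
      (Set.Ioc_subset_Icc_self (h.grid.mem_Ioc hi.le)) hη (hF i hi)) hn hδ hεn hd
  filter_upwards [hcap, hcomb, eventually_one_le_fst_whp] with x hxcap hxcomb hm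
  rw [relEst, storeyHat_div hm]
  exact max_le (hxcomb.trans (sub_le_self _ (by positivity))) (hxcap.trans hc.le)

omit [∀ m, IsProbabilityMeasure (P m)] in
theorem tendsto_compl_card_div_sqrt
    (hs : κ₀ = 1 →
      Tendsto (fun m : ℕ => (((I₀ m)ᶜ.card : ℕ) : ℝ) / Real.sqrt (m : ℝ)) atTop atTop) :
    Tendsto (fun m : ℕ => (((I₀ m)ᶜ.card : ℕ) : ℝ) / Real.sqrt (m : ℝ)) atTop atTop := by
  rcases h.kappa_le.lt_or_eq with hlt | heq
  · exact tendsto_div_sqrt_atTop_of_tendsto_div (sub_pos.2 hlt)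
      (tendsto_compl_card_div h.tendsto_card)
  · exact hs heq

theorem exists_tendsto_relEst
    (hβ : ∀ i ∈ Finset.Icc 1 k, Tendsto (fun x : Σ m, Ω m => weights (b x.1) (p x.1 x.2) i)
      (whp P) (𝓝 (β i)))
    (hε : ∀ i < k, 0 ≤ ε i)
    (hF : ∀ i < k, Tendsto (fun x : Σ m, Ω m => empCDF (I₀ x.1)ᶜ (p x.1 x.2) (lam i)) (whp P)
      (𝓝 (lam i + ε i))) :
    ∃ C ≥ α, Tendsto (relEst p α k lam b) (whp P) (𝓝 C) := by
  have hlim : ∀ i < k, Tendsto (fun x : Σ m, Ω m => empCDF Finset.univ (p x.1 x.2) (lam i))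
      (whp P) (𝓝 (κ₀ * lam i + (1 - κ₀) * (lam i + ε i))) := fun i hi =>
    tendsto_empCDF_univ h.basic h.tendsto_card (h.grid.mem_Ioc hi.le)
      (((tendsto_compl_card_div h.tendsto_card).comp tendsto_fst_whp).mul (hF i hi))
  have hlast : Tendsto (fun x : Σ m, Ω m => empCDF Finset.univ (p x.1 x.2) (lam k)) (whp P)
      (𝓝 1) := tendsto_const_nhds.congr' <| eventually_one_le_fst_whp.mono fun x hx =>
    (empCDF_univ_eq_one hx fun n => ((h.basic x.1).mem_Icc x.2 n).2.trans h.grid.last.ge).symm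
  have hlim' : ∀ i ≤ k, ∃ a, Tendsto (fun x : Σ m, Ω m => empCDF Finset.univ (p x.1 x.2) (lam i))
      (whp P) (𝓝 a) := fun i hi =>
    hi.lt_or_eq.elim (fun hlt => ⟨_, hlim i hlt⟩) fun heq => ⟨1, heq ▸ hlast⟩
  choose! f hf using hlim'
  have hcomb := tendsto_finsetSum (Finset.range k) fun i hi =>
    (tendsto_normWeight (lam := lam) hβ (i := i + 1) (Finset.mem_range.1 hi)).mul
      (((hf (i + 1) (Finset.mem_range.1 hi)).sub (hf i (Finset.mem_range.1 hi).le)).add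
        (tendsto_const_div_fst_whp 1))
  have hcap := (hlim 0 h.grid.k_pos).const_mul (α / lam 0)
  refine ⟨_, le_trans ?_ (le_max_right _ _), (hcomb.max hcap).congr' ?_⟩
  · have hl := h.grid.zero_pos
    have hα := h.alpha_pos
    have hκε := mul_nonneg (sub_nonneg.2 h.kappa_le) (hε 0 h.grid.k_pos)
    calc α = α / lam 0 * lam 0 := (div_mul_cancel₀ _ hl.ne').symm
      _ ≤ _ := by gcongr; linarith
  · filter_upwards [eventually_one_le_fst_whp] with x hx
    rw [relEst, storeyHat_div hx, storeyComb_div hx]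

theorem consistent_of_tendsto (hC : C ≠ 0)
    (hhat : Tendsto (relEst p α k lam b) (whp P) (𝓝 C))
    (hR : Tendsto (fun x : Σ m, Ω m =>
      adaptiveRej α (lam 0) (storeyEst α k lam (b x.1)) (p x.1 x.2)) (whp P) atTop) :
    Consistent P fun m ω => fdpStorey α k lam (b m) (I₀ m) (p m ω) := by
  simp only [h.fdp_eq]
  exact consistent_of_tendsto_nullFraction h.basic h.nullEstimator
    (h.tendsto_nullFraction hC hhat) hR

theorem consistent_of_consistent_fdpBH (hC : C ≠ 0)
    (hhat : Tendsto (relEst p α k lam b) (whp P) (𝓝 C))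
    (hle : ∀ᶠ x in whp P, relEst p α k lam b x ≤ 1)
    (hc : Consistent P fun m ω => fdpBH α (I₀ m) (p m ω)) :
    Consistent P fun m ω => fdpStorey α k lam (b m) (I₀ m) (p m ω) := by
  refine h.consistent_of_tendsto hC hhat (tendsto_atTop_mono' _ ?_
    (tendsto_rej_of_consistent h.basic h.alpha_pos h.alpha_lt_one.le h.kappa_pos.ne'
      h.tendsto_card hc))
  filter_upwards [hle, eventually_one_le_fst_whp] with x hx hm
  refine adaptiveRej_trivialEst_le h.alpha_pos.le h.alpha_le ((h.nullEstimator x.1).pos _) ?_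
  rw [h.storeyEst_eq_relEst_mul hm]
  exact mul_le_of_le_one_left (Nat.cast_nonneg _) hx

omit [∀ m, IsProbabilityMeasure (P m)] in
theorem tendsto_rej_of_eventually_le {c : ℝ} (hc : 0 < c)
    (hhat : ∀ᶠ x in whp P, relEst p α k lam b x ≤ c * α) {t : ℕ → ℝ}
    (ht : ∀ m, t m ∈ Set.Ioo 0 (lam 0))
    (hmt : Tendsto (fun m : ℕ => (m : ℝ) * t m) atTop atTop)
    (hN : ∀ᶠ x : Σ m, Ω m in whp P,
      c * (x.1 * t x.1) ≤ countLE Finset.univ (p x.1 x.2) (t x.1)) :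
    Tendsto (fun x : Σ m, Ω m =>
      adaptiveRej α (lam 0) (storeyEst α k lam (b x.1)) (p x.1 x.2)) (whp P) atTop := by
  rw [← tendsto_natCast_atTop_iff (R := ℝ)]
  refine tendsto_atTop_mono' _ ?_ ((hmt.const_mul_atTop hc).comp tendsto_fst_whp)
  filter_upwards [hhat, hN, eventually_one_le_fst_whp] with x hx hNx hm
  refine hNx.trans (Nat.cast_le.2 (countLE_le_adaptiveRej ((h.nullEstimator x.1).pos _)
    (ht x.1).2.le ?_))
  have hα := h.alpha_pos
  have ht' := (ht x.1).1
  calc t x.1 * storeyEst α k lam (b x.1) (p x.1 x.2)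
      ≤ t x.1 * (c * α * x.1) := by rw [h.storeyEst_eq_relEst_mul hm]; gcongr
    _ = c * (x.1 * t x.1) * α := by ring
    _ ≤ _ := by gcongr

theorem consistent_of_eventually_le (hC : 0 < C)
    (hhat : Tendsto (relEst p α k lam b) (whp P) (𝓝 C))
    {δ : ℝ} (hδ : 0 < δ) {t : ℕ → ℝ} (ht : ∀ m, t m ∈ Set.Ioo 0 (lam 0))
    (hmt : Tendsto (fun m : ℕ => (m : ℝ) * t m) atTop atTop)
    (hF : ∀ᶠ x : Σ m, Ω m in whp P, δ - κ₀ + 1 / α * C ≤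
      (((I₀ x.1)ᶜ.card : ℕ) : ℝ) / (x.1 : ℝ) *
        (empCDF (I₀ x.1)ᶜ (p x.1 x.2) (t x.1) / t x.1)) :
    Consistent P fun m ω => fdpStorey α k lam (b m) (I₀ m) (p m ω) := by
  have hα := h.alpha_pos
  have hlt : C < (1 / α * C + δ / 2) * α := by
    rw [add_mul, mul_right_comm, one_div_mul_cancel hα.ne', one_mul]
    exact lt_add_of_pos_right C (by positivity)
  exact h.consistent_of_tendsto hC.ne' hhat <| h.tendsto_rej_of_eventually_le (by positivity)
    ((hhat.eventually_lt_const hlt).mono fun _ => le_of_lt) ht hmt <|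
    eventually_mul_le_countLE h.basic h.tendsto_card
      (fun m => ⟨(ht m).1, ((ht m).2.trans h.grid.zero_lt).le⟩) hmt (by linarith) hF

theorem eventually_lt_empCDF_of_le_liminf {Q : Measure (∀ m, Ω m)} (hQ : IsJointLaw P Q)
    {t c c' : ℝ} (hc : c' < c)
    (hF : ∀ᵐ ω ∂Q, c ≤ liminf (fun m => empCDF Finset.univ (p m (ω m)) t) atTop) :
    ∀ᶠ x : Σ m, Ω m in whp P, c' < empCDF Finset.univ (p x.1 x.2) t :=
  eventually_whp_lt_of_ae_le_liminf hQ (fun m => h.measurable_empCDF_comp m Finset.univ t)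
    (fun _ _ => (empCDF_mem_Icc _ _ _).1) hc hF

theorem eventually_lt_normWeight_sub_of_le_liminf {Q : Measure (∀ m, Ω m)} (hQ : IsJointLaw P Q)
    {n : ℕ} (hn : n < k) {δ δ' : ℝ} (hδ : δ' < δ)
    (hd : ∀ᵐ ω ∂Q, δ ≤ liminf (fun m => normWeight lam (weights (b m) (p m (ω m))) (n + 1) -
      normWeight lam (weights (b m) (p m (ω m))) n) atTop) :
    ∀ᶠ x : Σ m, Ω m in whp P, δ' < normWeight lam (weights (b x.1) (p x.1 x.2)) (n + 1) -
      normWeight lam (weights (b x.1) (p x.1 x.2)) n := by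
  have hmeas : ∀ m, ∀ i ≤ k, Measurable fun ω => normWeight lam (weights (b m) (p m ω)) i :=
    fun m i hi => (measurable_normWeight_weights (h.weights_meas m) hi).comp
      (h.basic m).measurable_fun
  refine eventually_whp_lt_of_ae_le_liminf hQ
    (X := fun m ω => normWeight lam (weights (b m) (p m ω)) (n + 1) -
      normWeight lam (weights (b m) (p m ω)) n)
    (fun m => (hmeas m (n + 1) hn).sub (hmeas m n hn.le)) (B := -gridBound k lam)
    (fun m ω => ?_) hδ hd
  have hnonneg := normWeight_nonneg h.grid (h.weights_convex m ω).nonneg (i := n + 1) hn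
  have hbound := normWeight_le h.grid (h.weights_convex m ω) hn.le
  linarith

theorem exists_eventually_relEst_le_of_le_liminf {Q : Measure (∀ m, Ω m)} (hQ : IsJointLaw P Q)
    (hmono : ∀ m, ∀ᵐ ω ∂(P m), MonotoneWeights k lam (weights (b m) (p m ω)))
    (hε : ∀ i < k, 0 ≤ ε i)
    (hF : ∀ i < k, ∀ᵐ ω ∂Q,
      lam i + ε i ≤ liminf (fun m => empCDF Finset.univ (p m (ω m)) (lam i)) atTop)
    {n : ℕ} (hn : n < k) {δ : ℝ} (hδ : 0 < δ)
    (hd : ∀ᵐ ω ∂Q, δ ≤ liminf (fun m => normWeight lam (weights (b m) (p m (ω m))) (n + 1) -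
      normWeight lam (weights (b m) (p m (ω m))) n) atTop)
    (hεn : 0 < ε n) :
    ∃ c < 1, ∀ᶠ x in whp P, relEst p α k lam b x ≤ c :=
  h.exists_eventually_relEst_le hmono hε
    (fun i hi _ hc => h.eventually_lt_empCDF_of_le_liminf hQ hc (hF i hi)) hn (half_pos hδ) hεn
    ((h.eventually_lt_normWeight_sub_of_le_liminf hQ hn (half_lt_self hδ) hd).mono
      fun _ => le_of_lt)

theorem exists_tendsto_relEst_le_one {Q : Measure (∀ m, Ω m)} (hQ : IsJointLaw P Q)
    (hβ : ∀ i ∈ Finset.Icc 1 k,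
      ∀ᵐ ω ∂Q, Tendsto (fun m => weights (b m) (p m (ω m)) i) atTop (𝓝 (β i)))
    (hmono : ∀ m, ∀ᵐ ω ∂(P m), MonotoneWeights k lam (weights (b m) (p m ω)))
    (hε : ∀ i < k, 0 ≤ ε i)
    (hF : ∀ i < k, ∀ᵐ ω ∂Q,
      Tendsto (fun m => empCDF (I₀ m)ᶜ (p m (ω m)) (lam i)) atTop (𝓝 (lam i + ε i)))
    {n : ℕ} (hn : n < k) (hd : 0 < normWeight lam β (n + 1) - normWeight lam β n) (hεn : 0 < ε n)
    (hs : Tendsto (fun m : ℕ => (((I₀ m)ᶜ.card : ℕ) : ℝ) / Real.sqrt (m : ℝ)) atTop atTop) :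
    ∃ C ≥ α, Tendsto (relEst p α k lam b) (whp P) (𝓝 C) ∧
      ∀ᶠ x in whp P, relEst p α k lam b x ≤ 1 := by
  have hβ' : ∀ i ∈ Finset.Icc 1 k, Tendsto (fun x : Σ m, Ω m => weights (b x.1) (p x.1 x.2) i)
      (whp P) (𝓝 (β i)) := fun i hi =>
    tendsto_whp_of_ae_tendsto hQ (X := fun m ω => weights (b m) (p m ω) i)
      (fun m => h.measurable_weights_comp m hi) (hβ i hi)
  have hF' : ∀ i < k, Tendsto (fun x : Σ m, Ω m => empCDF (I₀ x.1)ᶜ (p x.1 x.2) (lam i))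
      (whp P) (𝓝 (lam i + ε i)) := fun i hi =>
    tendsto_whp_of_ae_tendsto hQ (X := fun m ω => empCDF (I₀ m)ᶜ (p m ω) (lam i))
      (fun m => h.measurable_empCDF_comp m _ _) (hF i hi)
  have hd' := ((tendsto_normWeight hβ' hn).sub
    (tendsto_normWeight hβ' hn.le)).eventually_const_lt (half_lt_self hd)
  obtain ⟨C, hC, hhat⟩ := h.exists_tendsto_relEst hβ' hε hF'
  exact ⟨C, hC, hhat, h.eventually_relEst_le_one hmono hε hF' hn (half_pos hd) hεn
    (hd'.mono fun _ => le_of_lt) hs⟩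

omit [∀ m, IsProbabilityMeasure (P m)] in
theorem measurableSet_le_empCDF_div (m : ℕ) (r t : ℝ) : MeasurableSet {ω | r ≤
    (((I₀ m)ᶜ.card : ℕ) : ℝ) / (m : ℝ) * (empCDF (I₀ m)ᶜ (p m ω) t / t)} :=
  measurableSet_le measurable_const (((h.measurable_empCDF_comp m _ t).div_const t).const_mul _)

end AdaptiveSetting

end MultipleTesting

theorem corollary5p5
    {Ω : ℕ → Type*} [∀ m, MeasurableSpace (Ω m)]
    (P : ∀ m, Measure (Ω m)) [∀ m, IsProbabilityMeasure (P m)]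
    (p : ∀ m, Ω m → Fin m → ℝ) (I₀ : ∀ m, Finset (Fin m))
    (hBI : ∀ m, BasicIndependence (P m) (p m) (I₀ m))
    (α : ℝ) (hα : 0 < α)
    (k : ℕ) (lam : ℕ → ℝ) (hαlam : α ≤ lam 0) (hlam0 : lam 0 < 1)
    (hlam : ∀ i < k, lam i < lam (i + 1)) (hlamk : lam k = 1)
    (b : ∀ _ : ℕ, ∀ i, (Set.Ici (lam i) → ℝ) → ℝ)
    (hb_meas : ∀ m, ∀ i ∈ Finset.Icc 1 k, Measurable (b m i))
    (hb_nonneg : ∀ m, ∀ ω : Ω m, ∀ i ∈ Finset.Icc 1 k, 0 ≤ weights (b m) (p m ω) i)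
    (hb_sum : ∀ m, ∀ ω : Ω m, ∑ i ∈ Finset.Icc 1 k, weights (b m) (p m ω) i = 1)
    (κ₀ : ℝ) (hκ₀ : 0 < κ₀) (hκ₀_le : κ₀ ≤ 1)
    (hA1 : Tendsto (fun m : ℕ => ((I₀ m).card : ℝ) / (m : ℝ)) atTop (𝓝 κ₀))
    (hA5 : α * (1 - κ₀) / (lam 0 * (1 - α)) < κ₀) :
    -- (a)
    (κ₀ = 1 →
      ConvInProb P (fun m ω => storeyHat α k lam (weights (b m) (p m ω)) (p m ω) / (m : ℝ)) 1 ∧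
      Tendsto (fun m => ∫ ω, fdpStorey α k lam (b m) (I₀ m) (p m ω) ∂(P m)) atTop (𝓝 α) ∧
      Tendsto (fun m => ∫ ω, fdpBH α (I₀ m) (p m ω) ∂(P m)) atTop (𝓝 α)) ∧
    -- (b)
    (∀ Q : Measure (∀ m, Ω m), IsJointLaw P Q →
      κ₀ < 1 →
      (∀ m, ∀ᵐ ω ∂(P m), MonotoneWeights k lam (weights (b m) (p m ω))) →
      ∀ ε : ℕ → ℝ, (∀ i < k, ε i ∈ Set.Icc 0 (1 - lam i)) →
      (∀ i < k, ∀ᵐ ω ∂Q,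
        lam i + ε i ≤ liminf (fun m => empCDF Finset.univ (p m (ω m)) (lam i)) atTop) →
      (∃ j ∈ Finset.Icc 1 k, ∃ δ : ℝ, 0 < δ ∧
        (∀ᵐ ω ∂Q, δ ≤ liminf (fun m => normWeight lam (weights (b m) (p m (ω m))) j
          - normWeight lam (weights (b m) (p m (ω m))) (j - 1)) atTop) ∧
        0 < ε (j - 1)) →
      κ₀ * α < liminf (fun m => ∫ ω, fdpStorey α k lam (b m) (I₀ m) (p m ω) ∂(P m)) atTop ∧
      Tendsto (fun m => ∫ ω, fdpBH α (I₀ m) (p m ω) ∂(P m)) atTop (𝓝 (κ₀ * α))) ∧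
    -- (c)
    (∀ Q : Measure (∀ m, Ω m), IsJointLaw P Q →
      ∀ β : ℕ → ℝ,
      (∀ i ∈ Finset.Icc 1 k,
        ∀ᵐ ω ∂Q, Tendsto (fun m => weights (b m) (p m (ω m)) i) atTop (𝓝 (β i))) →
      (∀ m, ∀ᵐ ω ∂(P m), MonotoneWeights k lam (weights (b m) (p m ω))) →
      ∀ ε : ℕ → ℝ, (∀ i < k, ε i ∈ Set.Icc 0 (1 - lam i)) →
      (∀ i < k, ∀ᵐ ω ∂Q,
        Tendsto (fun m => empCDF (I₀ m)ᶜ (p m (ω m)) (lam i)) atTop (𝓝 (lam i + ε i))) →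
      (∃ j ∈ Finset.Icc 1 k, 0 < normWeight lam β j - normWeight lam β (j - 1) ∧ 0 < ε (j - 1)) →
      (κ₀ = 1 →
        Tendsto (fun m : ℕ => (((I₀ m)ᶜ.card : ℕ) : ℝ) / Real.sqrt (m : ℝ)) atTop atTop) →
      ∃ C₀ ∈ Set.Icc (κ₀ * α) 1,
        ConvInProb P
          (fun m ω => storeyHat α k lam (weights (b m) (p m ω)) (p m ω) / (m : ℝ)) C₀ ∧
        (Consistent P (fun m ω => fdpBH α (I₀ m) (p m ω)) →
          Consistent P (fun m ω => fdpStorey α k lam (b m) (I₀ m) (p m ω))) ∧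
        (∀ δ : ℝ, 0 < δ → ∀ t : ℕ → ℝ, (∀ m, t m ∈ Set.Ioo 0 (lam 0)) →
          Tendsto (fun m : ℕ => (m : ℝ) * t m) atTop atTop →
          Tendsto (fun m : ℕ => P m {ω | δ - κ₀ + 1 / α * C₀ ≤
              (((I₀ m)ᶜ.card : ℕ) : ℝ) / (m : ℝ) *
                (empCDF (I₀ m)ᶜ (p m ω) (t m) / t m)}) atTop (𝓝 1) →
          Consistent P (fun m ω => fdpStorey α k lam (b m) (I₀ m) (p m ω)))) := by
  have h : AdaptiveSetting P p I₀ α k lam b κ₀ :=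
    ⟨hBI, hα, hαlam, ⟨hα.trans_le hαlam, hlam0, hlam, hlamk⟩, hb_meas,
      fun m ω => ⟨hb_nonneg m ω, hb_sum m ω⟩, hκ₀, hκ₀_le, hA1, hA5⟩
  have hBH := tendsto_integral_fdpBH hBI hα h.alpha_lt_one.le hA1
  refine ⟨?_, fun Q hQ _ hmono ε hε hF ⟨j, hj, δ, hδ, hd, hεj⟩ => ⟨?_, hBH⟩,
    fun Q hQ β hβ hmono ε hε hF ⟨j, hj, hd, hεj⟩ hs => ?_⟩
  · rintro rfl
    have hhat := h.tendsto_relEst_of_tendsto_card hA1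
    have hfdp := h.tendsto_integral_fdp_of_tendsto one_ne_zero hhat
    rw [one_mul] at hBH hfdp
    exact ⟨convInProb_iff_tendsto_whp.2 hhat, by rwa [div_one] at hfdp, hBH⟩
  · obtain ⟨n, rfl⟩ := Nat.exists_eq_add_of_le' (Finset.mem_Icc.1 hj).1
    obtain ⟨c, hc, hle⟩ := h.exists_eventually_relEst_le_of_le_liminf hQ hmono
      (fun i hi => (hε i hi).1) hF (Finset.mem_Icc.1 hj).2 hδ hd hεj
    exact h.lt_liminf_integral_fdp hc hle
  · obtain ⟨n, rfl⟩ := Nat.exists_eq_add_of_le' (Finset.mem_Icc.1 hj).1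
    obtain ⟨C, hC, hhat, hle⟩ := h.exists_tendsto_relEst_le_one hQ hβ hmono
      (fun i hi => (hε i hi).1) hF (Finset.mem_Icc.1 hj).2 hd hεj (h.tendsto_compl_card_div_sqrt hs)
    have hC₀ := hα.trans_le hC
    exact ⟨C, ⟨(mul_le_of_le_one_left hα.le hκ₀_le).trans hC, le_of_tendsto hhat hle⟩,
      convInProb_iff_tendsto_whp.2 hhat, h.consistent_of_consistent_fdpBH hC₀.ne' hhat hle,
      fun δ hδ t ht hmt hP => h.consistent_of_eventually_le hC₀ hhat hδ ht hmt <|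
        (eventually_whp_iff_tendsto_measure_one fun m =>
          h.measurableSet_le_empCDF_div m _ (t m)).2 hP⟩
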